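/- **Setting.** Let $t=(t^{(1)},t^{(2)},t^{(3)})$ with $t^{(i)}=(t^{(i)}_1,t^{(i)}_2,\dots)$ be three infinite families of formal times and put $\xi(t^{(i)},z)=\sum_{k\ge1}t^{(i)}_kz^k$. For $\mathbf m=(m_1,m_2)\in\mathbb Z^2$ let $\mathbf e_1=(1,0)$, $\mathbf e_2=(0,1)$, $\mathbf e=(1,1)$, and let $t\mp[y]_i$ denote $t$ with $t^{(i)}_k$ replaced by $t^{(i)}_k\mp y^k/k$ for all $k\ge1$. Let $n_1,n_2,n_3\ge0$ be integers and let $\tau_{\mathbf m}(t)\in\mathbb C[[t]]$, $\mathbf m\in\mathbb Z^2$, be nonzero formal power series forming a tau function of the $[n_1,n_2,n_3]$-KdV hierarchy, i.e. for all $\mathbf m,\mathbf m'\in\mathbb Z^2$ and all integers $l\ge0$ $$\oint_{C_R}\frac{dz}{2\pi i}z^{n_1l+m_1-m_1'}e^{\xi(t^{(1)}-t'^{(1)},z)}\tau_{\mathbf m}(t-[z^{-1}]_1)\tau_{\mathbf m'}(t'+[z^{-1}]_1)$$ $$=\oint_{C_r}\frac{dz}{2\pi i}z^{-n_2l+m_2-m_2'}e^{\xi(t^{(2)}-t'^{(2)},z^{-1})}\tau_{\mathbf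 m+\mathbf e}(t-[z]_2)\tau_{\mathbf m'-\mathbf e}(t'+[z]_2)$$ $$+\oint_{C_r}\frac{dz}{2\pi i}(-1)^{m_2+m_2'}z^{-n_3l+m_1-m_2-m_1'+m_2'}e^{\xi(t^{(3)}-t'^{(3)},z^{-1})}\tau_{\mathbf m+\mathbf e_1}(t-[z]_3)\tau_{\mathbf m'-\mathbf e_1}(t'+[z]_3),$$ where the contour integrals (over a large circle $C_R$ and a small circle $C_r$) are understood formally, as the coefficient of $z^{-1}$ of the expanded integrand, an identity in $\mathbb C[[t,t']]$. Define the wave functions, series in $z^{\pm1}$ with coefficients in $\mathrm{Frac}\,\mathbb C[[t]]$, by $$\Psi_1=z^{m_1}e^{\xi(t^{(1)},z)}\frac{\tau_{\mathbf m}(t-[z^{-1}]_1)}{\tau_{\mathbf m}(t)},\quad \Psi_2=z^{m_2}e^{\xi(t^{(2)},z^{-1})}\frac{\tau_{\mathbf m+\mathbf e}(t-[z]_2)}{\tau_{\mathbf m}(t)},\quad \Psi_3=(-1)^{m_2}z^{m_1-m_2}e^{\xi(t^{(3)},z^{-1})}\frac{\tau_{\mathbf m+\mathbf e_1}(t-[z]_3)}{\tau_{\mathbf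 m}(t)}.$$ Let $\Lambda_i$ be the shift $\mathbf m\mapsto\mathbf m+\mathbf e_i$. Define the operators $$S_1(\Lambda_1)=\sum_{k\ge0}a^{(1)}_k\Lambda_1^{-k},\quad S_2(\Lambda_2)=\sum_{k\ge0}a^{(2)}_k\Lambda_2^{k},\quad S_3(\Lambda_1)=\sum_{k\ge0}a^{(3)}_k\Lambda_1^{k},\quad S_3(\Lambda_2^{-1})=\sum_{k\ge0}a^{(3)}_k\Lambda_2^{-k},$$ where $a^{(1)}_k$ is the coefficient of $z^{-k}$ in $\tau_{\mathbf m}(t-[z^{-1}]_1)/\tau_{\mathbf m}(t)$, and $a^{(2)}_k$, $a^{(3)}_k$ are the coefficients of $z^k$ in $\tau_{\mathbf m+\mathbf e}(t-[z]_2)/\tau_{\mathbf m}(t)$ and $(-1)^{m_2}\tau_{\mathbf m+\mathbf e_1}(t-[z]_3)/\tau_{\mathbf m}(t)$. These are invertible; put $$L_1(\Lambda_1)=S_1\Lambda_1S_1^{-1},\quad L_2(\Lambda_2)=S_2\Lambda_2^{-1}S_2^{-1},\quad L_3(\Lambda_1)=S_3(\Lambda_1)\Lambda_1^{-1}S_3(\Lambda_1)^{-1},\quad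 L_3(\Lambda_2^{-1})=S_3(\Lambda_2^{-1})\Lambda_2S_3(\Lambda_2^{-1})^{-1}.$$ For $k\ge0$ let $B^{(1)}_k(\Lambda_1)$ be the part of $L_1^k$ with nonnegative powers of $\Lambda_1$; $B^{(2)}_k(\Lambda_2)$ the part of $L_2^k$ with powers $\ge1$ of $\Delta_2^*=\Lambda_2^{-1}-1$, when $L_2^k$ is expanded in powers of $\Delta_2^*$; $B^{(3)}_k(\Lambda_1)$ the part of $L_3(\Lambda_1)^k$ with negative powers of $\Lambda_1$; $B^{(3)}_k(\Lambda_2^{-1})$ the part of $L_3(\Lambda_2^{-1})^k$ with powers $\ge1$ of $\Delta_2=\Lambda_2-1$, when $L_3(\Lambda_2^{-1})^k$ is expanded in powers of $\Delta_2$. (Expansions use $(\Delta+1)^i=\sum_{j\ge0}\binom ij\Delta^{i-j}$, $i\in\mathbb Z$.) All these parts are finite sums. **Theorem.** The difference operators $$\mathcal L=B^{(1)}_{n_1}(\Lambda_1)+B^{(2)}_{n_2}(\Lambda_2)+B^{(3)}_{n_3}(\Lambda_1),\qquad \widetilde{\mathcal L}=B^{(1)}_{n_1}(\Lambda_1)+B^{(2)}_{n_2}(\Lambda_2)+B^{(3)}_{n_3}(\Lambda_2^{-1})$$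 satisfy $$\mathcal L(\Psi_1)=z^{n_1}\Psi_1,\quad \mathcal L(\Psi_2)=z^{-n_2}\Psi_2,\quad \mathcal L(\Psi_3)=z^{-n_3}\Psi_3,$$ $$\widetilde{\mathcal L}(\Psi_1)=z^{n_1}\Psi_1,\quad \widetilde{\mathcal L}(\Psi_2)=z^{-n_2}\Psi_2,\quad \widetilde{\mathcal L}(\Psi_3)=z^{-n_3}\Psi_3.$$ -/

import Mathlib

/-!
Three-component KP: formal tau functions, wave functions, wave operators, Lax operators.
-/

noncomputable section

namespace ThreeKP

/-! ### Times, coefficient field, lattice -/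

/-- The index `(i, k)` stands for the time `t_k^{(i+1)}`, with `i + 1 ∈ {1, 2, 3}` and `k ≥ 1`. -/
abbrev Var : Type := Fin 3 × ℕ+

/-- Formal power series over `ℂ` in the variables indexed by `ι`. -/
abbrev Ser (ι : Type) : Type := MvPowerSeries ι ℂ

/-- The field of fractions of the ring of formal power series in all the times. -/
abbrev TField : Type := FractionRing (Ser Var)

/-- The lattice of the discrete variables `m = (m₁, m₂)`. -/
abbrev Lat : Type := ℤ × ℤ

/-- The functions of `m` and `t`, i.e. the coefficients of all operators. -/
abbrev Coef : Type := Lat → TField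

/-- The lattice acts on functions by shifts: `(v • f)(m) = f(m + v)`. -/
instance : MulSemiringAction (Multiplicative Lat) Coef where
  smul v f := fun m => f (m + v.toAdd)
  one_smul f := by
    funext m
    change f (m + 0) = f m
    rw [add_zero]
  mul_smul v w f := by
    funext m
    change f (m + (v.toAdd + w.toAdd)) = f (m + v.toAdd + w.toAdd)
    rw [add_assoc]
  smul_zero _ := rfl
  smul_add _ _ _ := rfl
  smul_one _ := rfl
  smul_mul _ _ _ := rfl

/-! ### Series in `z`

A series in `z`, infinite in both directions, is the function `n ↦ (coefficient of z ^ n)`. -/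

/-- The product `z ^ N * f`. -/
def zPow {A : Type} (N : ℤ) (f : ℤ → A) : ℤ → A := fun n => f (n - N)

/-- The product of two series in `z` whose coefficients are formal power series: the coefficient
of `z ^ n x ^ d` is the sum over `k` of the coefficients of `x ^ d` in `f k * g (n - k)`. In all
uses below this sum has finitely many nonzero terms. -/
def zMul {ι : Type} (f g : ℤ → Ser ι) : ℤ → Ser ι :=
  fun n d => ∑ᶠ k : ℤ, MvPowerSeries.coeff d (f k * g (n - k))

/-- The exponential `exp (∑ s, c s * z ^ (w s) * x s)
= ∑ d, (∏ s, (c s) ^ (d s) / (d s)!) * z ^ (∑ s, d s * w s) * x ^ d`. -/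
def zExp {ι : Type} (c : ι → ℂ) (w : ι → ℤ) : ℤ → Ser ι :=
  fun n d => if (d.sum fun s a => (a : ℤ) * w s) = n
    then d.prod fun s a => c s ^ a / (a.factorial : ℂ) else 0

/-- The local parameter belonging to the `i`-th family of times is `y_i = z ^ (locExp i)`, i.e.
`y = z⁻¹` for the first family, `y = z` for the second and for the third. -/
def locExp : Fin 3 → ℤ := ![-1, 1, 1]

/-- The coefficient of `y ^ j` in `f (t + ε [y]_i)`, by Taylor's formula; here `t + ε [y]_i` is `t`
with `t_k^{(i)}` replaced by `t_k^{(i)} + ε * y ^ k / k` for all `k ≥ 1`. -/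
def miwaCoeff (ε : ℂ) (i : Fin 3) (j : ℕ) (f : Ser Var) : Ser Var :=
  fun d => ∑ᶠ e : ℕ+ →₀ ℕ,
    if (e.sum fun k a => a * (k : ℕ)) = j then
      (e.prod fun k a => ((d (i, k) + a).choose a : ℂ) * (ε / (k : ℕ)) ^ a) *
        MvPowerSeries.coeff (d + e.mapDomain (Prod.mk i)) f
    else 0

/-- `f (t + ε [y_i]_i)` as a series in `z`. -/
def miwa (ε : ℂ) (i : Fin 3) (f : Ser Var) : ℤ → Ser Var :=
  fun n => if 0 ≤ locExp i * n then miwaCoeff ε i (locExp i * n).toNat f else 0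

/-- `exp (ξ (t^{(i)}, y_i⁻¹))`, where `ξ (t, z) = ∑ k, t_k z ^ k`. -/
def expXi (i : Fin 3) : ℤ → Ser Var :=
  zExp (fun s => if s.1 = i then 1 else 0) (fun s => -locExp i * (s.2 : ℕ))

/-- `exp (ξ (t^{(i)} - t'^{(i)}, y_i⁻¹))`, in the doubled set `(t, t')` of times. -/
def expXiDiff (i : Fin 3) : ℤ → Ser (Var ⊕ Var) :=
  zExp (Sum.elim (fun s => if s.1 = i then 1 else 0) (fun s => if s.1 = i then -1 else 0))
    (Sum.elim (fun s => -locExp i * (s.2 : ℕ)) (fun s => -locExp i * (s.2 : ℕ)))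

/-- The formal contour integral (residue, i.e. coefficient of `z ^ (-1)`) of
`z ^ N * exp (ξ (t^{(i)} - t'^{(i)}, y_i⁻¹)) * f (t - [y_i]_i) * g (t' + [y_i]_i)`. -/
def bilinearRes (i : Fin 3) (N : ℤ) (f g : Ser Var) : Ser (Var ⊕ Var) :=
  zPow N (zMul (expXiDiff i)
    (zMul (fun n => MvPowerSeries.rename Function.Embedding.inl (miwa (-1) i f n))
      (fun n => MvPowerSeries.rename Function.Embedding.inr (miwa 1 i g n)))) (-1)

/-- The family `τ` of tau functions satisfies the bilinear equations of the
`[n₁, n₂, n₃]`-KdV hierarchy. -/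
def IsKdVTau (n₁ n₂ n₃ : ℕ) (τ : Lat → Ser Var) : Prop :=
  ∀ (m m' : Lat) (l : ℕ),
    bilinearRes 0 (n₁ * l + m.1 - m'.1) (τ m) (τ m') =
      bilinearRes 1 (-(n₂ * l) + m.2 - m'.2) (τ (m + (1, 1))) (τ (m' - (1, 1))) +
      (-1 : ℂ) ^ (m.2 + m'.2) •
        bilinearRes 2 (-(n₃ * l) + m.1 - m.2 - m'.1 + m'.2)
          (τ (m + (1, 0))) (τ (m' - (1, 0)))

/-! ### Wave functions -/

/-- The series `z ^ N * exp (ξ (t^{(i)}, y_i⁻¹)) * f (t - [y_i]_i) / g (t)`. -/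
def waveSer (i : Fin 3) (N : ℤ) (f g : Ser Var) : ℤ → TField :=
  zPow N fun n => algebraMap (Ser Var) TField (zMul (expXi i) (miwa (-1) i f) n) /
    algebraMap (Ser Var) TField g

/-- `Ψ₁ = z ^ m₁ * exp (ξ (t^{(1)}, z)) * τ_m (t - [z⁻¹]_1) / τ_m (t)`. -/
def Psi1 (τ : Lat → Ser Var) : Lat → ℤ → TField :=
  fun m => waveSer 0 m.1 (τ m) (τ m)

/-- `Ψ₂ = z ^ m₂ * exp (ξ (t^{(2)}, z⁻¹)) * τ_{m + e₁ + e₂} (t - [z]_2) / τ_m (t)`. -/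
def Psi2 (τ : Lat → Ser Var) : Lat → ℤ → TField :=
  fun m => waveSer 1 m.2 (τ (m + (1, 1))) (τ m)

/-- `Ψ₃ = (-1) ^ m₂ * z ^ (m₁ - m₂) * exp (ξ (t^{(3)}, z⁻¹)) * τ_{m + e₁} (t - [z]_3) / τ_m (t)`. -/
def Psi3 (τ : Lat → Ser Var) : Lat → ℤ → TField :=
  fun m n => (-1) ^ m.2 * waveSer 2 (m.1 - m.2) (τ (m + (1, 0))) (τ m) n

/-! ### Difference operators -/

/-- The ring of difference operators `∑ a_{ij}(m) Λ₁ ^ i Λ₂ ^ j` (finite sums), with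
`Λ ^ v · a(m) = a(m + v) · Λ ^ v`. -/
abbrev DiffOp : Type := SkewMonoidAlgebra Coef (Multiplicative Lat)

/-- The operator `a(m) · Λ₁ ^ v₁ Λ₂ ^ v₂`. -/
def term (a : Coef) (v : Lat) : DiffOp := SkewMonoidAlgebra.single (Multiplicative.ofAdd v) a

/-- The action of a difference operator on functions of `m` with values in series in `z`. -/
def DiffOp.act (A : DiffOp) (Φ : Lat → ℤ → TField) : Lat → ℤ → TField :=
  fun m n => A.sum fun v a => a m * Φ (m + v.toAdd) n

/-! ### Pseudo-difference operators -/

/-- The formal operators `∑_{j ≥ N} a_j(m) x ^ j` where `x = Λ ^ v = Λ₁ ^ v₁ Λ₂ ^ v₂`. -/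
@[ext]
structure PDO (v : Lat) where
  /-- the coefficients -/
  coeff : ℤ → Coef
  bddBelow : ∃ N : ℤ, ∀ j < N, coeff j = 0

namespace PDO

variable {v : Lat}

/-- The shift `f(m) ↦ f(m + j v)`. -/
def sh (v : Lat) (j : ℤ) (f : Coef) : Coef := Multiplicative.ofAdd (j • v) • f

theorem sh_zero' (j : ℤ) : sh v j 0 = 0 := rfl

theorem sh_one' (j : ℤ) : sh v j 1 = 1 := rfl

theorem sh_add' (j : ℤ) (f g : Coef) : sh v j (f + g) = sh v j f + sh v j g := rfl

theorem sh_mul' (j : ℤ) (f g : Coef) : sh v j (f * g) = sh v j f * sh v j g := rfl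

theorem zero_sh (f : Coef) : sh v 0 f = f := by simp [sh]

theorem add_sh (i j : ℤ) (f : Coef) : sh v (i + j) f = sh v i (sh v j f) := by
  simp [sh, add_smul, mul_smul]

theorem sh_sum {ι : Type*} (s : Finset ι) (j : ℤ) (f : ι → Coef) :
    sh v j (∑ i ∈ s, f i) = ∑ i ∈ s, sh v j (f i) := by
  simp [sh, Finset.smul_sum]

/-- The coefficient of `x ^ n` in the product of `∑ a_i x ^ i` and `∑ b_j x ^ j` is
`∑ a_i(m) b_{n-i}(m + i v)`. -/
def mulCoeff (v : Lat) (a b : ℤ → Coef) (n : ℤ) : Coef :=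
  ∑ᶠ i : ℤ, a i * sh v i (b (n - i))

theorem mulCoeff_eq {a b : ℤ → Coef} {M N : ℤ} (ha : ∀ j < M, a j = 0) (hb : ∀ j < N, b j = 0)
    (n : ℤ) (s : Finset ℤ) (hs : Finset.Icc M (n - N) ⊆ s) :
    mulCoeff v a b n = ∑ i ∈ s, a i * sh v i (b (n - i)) := by
  refine finsum_eq_sum_of_support_subset _ fun i hi => ?_
  apply hs
  rw [Finset.mem_Icc]
  by_contra h
  apply hi
  by_cases h1 : i < M
  · simp [ha i h1]
  · simp only [hb (n - i) (by lia), sh_zero', mul_zero]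

theorem mulCoeff_lt {a b : ℤ → Coef} {M N : ℤ} (ha : ∀ j < M, a j = 0) (hb : ∀ j < N, b j = 0)
    (n : ℤ) (hn : n < M + N) : mulCoeff v a b n = 0 := by
  rw [mulCoeff_eq ha hb n (Finset.Icc M (n - N)) subset_rfl, Finset.Icc_eq_empty (by lia),
    Finset.sum_empty]

instance : Zero (PDO v) := ⟨⟨0, 0, fun _ _ => rfl⟩⟩

instance : Add (PDO v) := ⟨fun A B => ⟨A.coeff + B.coeff, by
  obtain ⟨M, hM⟩ := A.bddBelow
  obtain ⟨N, hN⟩ := B.bddBelow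
  exact ⟨min M N, fun j hj => by
    simp [hM j (lt_of_lt_of_le hj (min_le_left _ _)),
      hN j (lt_of_lt_of_le hj (min_le_right _ _))]⟩⟩⟩

instance : Neg (PDO v) := ⟨fun A => ⟨-A.coeff, by
  obtain ⟨M, hM⟩ := A.bddBelow
  exact ⟨M, fun j hj => by simp [hM j hj]⟩⟩⟩

instance : Mul (PDO v) := ⟨fun A B => ⟨mulCoeff v A.coeff B.coeff, by
  obtain ⟨M, hM⟩ := A.bddBelow
  obtain ⟨N, hN⟩ := B.bddBelow
  exact ⟨M + N, mulCoeff_lt hM hN⟩⟩⟩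

/-- The operator `a(m) x ^ j`. -/
def mono (v : Lat) (j : ℤ) (a : Coef) : PDO v :=
  ⟨fun i => if i = j then a else 0, j, fun _ hi => if_neg hi.ne⟩

instance : One (PDO v) := ⟨mono v 0 1⟩

theorem zero_coeff : (0 : PDO v).coeff = 0 := rfl

theorem add_coeff (A B : PDO v) : (A + B).coeff = A.coeff + B.coeff := rfl

theorem neg_coeff (A : PDO v) : (-A).coeff = -A.coeff := rfl

theorem mul_coeff (A B : PDO v) : (A * B).coeff = mulCoeff v A.coeff B.coeff := rfl

theorem one_coeff (i : ℤ) : (1 : PDO v).coeff i = if i = 0 then 1 else 0 := rfl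

theorem mul_assoc' (A B C : PDO v) : A * B * C = A * (B * C) := by
  obtain ⟨a, ha⟩ := A.bddBelow
  obtain ⟨b, hb⟩ := B.bddBelow
  obtain ⟨c, hc⟩ := C.bddBelow
  apply PDO.ext
  funext n
  have hL := mulCoeff_lt (v := v) ha hb
  have hR := mulCoeff_lt (v := v) hb hc
  simp only [mul_coeff]
  rw [mulCoeff_eq hL hc n (Finset.Icc (a + b) (n - c)) subset_rfl,
    mulCoeff_eq ha hR n (Finset.Icc a (n - (b + c))) subset_rfl]
  have h1 : ∀ j ∈ Finset.Icc (a + b) (n - c),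
      mulCoeff v A.coeff B.coeff j * sh v j (C.coeff (n - j)) =
        ∑ i ∈ Finset.Icc a (n - (b + c)),
          A.coeff i * sh v i (B.coeff (j - i)) * sh v j (C.coeff (n - j)) := by
    intro j hj
    rw [Finset.mem_Icc] at hj
    rw [mulCoeff_eq ha hb j (Finset.Icc a (n - (b + c)))
      (Finset.Icc_subset_Icc_right (by lia)), Finset.sum_mul]
  rw [Finset.sum_congr rfl h1, Finset.sum_comm]
  refine Finset.sum_congr rfl fun i hi => ?_
  rw [Finset.mem_Icc] at hi
  rw [mulCoeff_eq hb hc (n - i) (Finset.Icc (a + b - i) (n - c - i))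
    (Finset.Icc_subset_Icc (by lia) (by lia)), sh_sum, Finset.mul_sum]
  refine Finset.sum_nbij' (fun j => j - i) (fun k => k + i) ?_ ?_ ?_ ?_ ?_
  · intro j hj
    rw [Finset.mem_Icc] at hj ⊢
    lia
  · intro j hj
    rw [Finset.mem_Icc] at hj ⊢
    lia
  · intro j _
    lia
  · intro j _
    lia
  · intro j _
    rw [sh_mul', ← add_sh, mul_assoc, show i + (j - i) = j by lia,
      show n - i - (j - i) = n - j by lia]

theorem left_distrib' (A B C : PDO v) : A * (B + C) = A * B + A * C := by
  obtain ⟨a, ha⟩ := A.bddBelow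
  obtain ⟨b, hb⟩ := B.bddBelow
  obtain ⟨c, hc⟩ := C.bddBelow
  obtain ⟨d, hd⟩ := (B + C).bddBelow
  apply PDO.ext
  funext n
  rw [add_coeff, Pi.add_apply, mul_coeff, mul_coeff, mul_coeff]
  have key : ∀ e ∈ ({b, c, d} : Finset ℤ), min b (min c d) ≤ e := by
    intro e he
    simp only [Finset.mem_insert, Finset.mem_singleton] at he
    lia
  rw [mulCoeff_eq ha hd n (Finset.Icc a (n - min b (min c d)))
      (Finset.Icc_subset_Icc_right (by have := key d (by simp); lia)),
    mulCoeff_eq ha hb n (Finset.Icc a (n - min b (min c d)))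
      (Finset.Icc_subset_Icc_right (by have := key b (by simp); lia)),
    mulCoeff_eq ha hc n (Finset.Icc a (n - min b (min c d)))
      (Finset.Icc_subset_Icc_right (by have := key c (by simp); lia)), ← Finset.sum_add_distrib]
  refine Finset.sum_congr rfl fun i _ => ?_
  rw [add_coeff, Pi.add_apply, sh_add', mul_add]

theorem right_distrib' (A B C : PDO v) : (A + B) * C = A * C + B * C := by
  obtain ⟨a, ha⟩ := A.bddBelow
  obtain ⟨b, hb⟩ := B.bddBelow
  obtain ⟨c, hc⟩ := C.bddBelow
  obtain ⟨d, hd⟩ := (A + B).bddBelow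
  apply PDO.ext
  funext n
  rw [add_coeff, Pi.add_apply, mul_coeff, mul_coeff, mul_coeff]
  have key : ∀ e ∈ ({a, b, d} : Finset ℤ), min a (min b d) ≤ e := by
    intro e he
    simp only [Finset.mem_insert, Finset.mem_singleton] at he
    lia
  rw [mulCoeff_eq hd hc n (Finset.Icc (min a (min b d)) (n - c))
      (Finset.Icc_subset_Icc_left (key d (by simp))),
    mulCoeff_eq ha hc n (Finset.Icc (min a (min b d)) (n - c))
      (Finset.Icc_subset_Icc_left (key a (by simp))),
    mulCoeff_eq hb hc n (Finset.Icc (min a (min b d)) (n - c))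
      (Finset.Icc_subset_Icc_left (key b (by simp))), ← Finset.sum_add_distrib]
  refine Finset.sum_congr rfl fun i _ => ?_
  rw [add_coeff, Pi.add_apply, add_mul]

theorem one_mul' (A : PDO v) : 1 * A = A := by
  apply PDO.ext
  funext n
  rw [mul_coeff, mulCoeff, finsum_eq_single _ 0 fun i hi => by
    rw [one_coeff, if_neg hi, zero_mul]]
  rw [one_coeff, if_pos rfl, one_mul, zero_sh, sub_zero]

theorem mul_one' (A : PDO v) : A * 1 = A := by
  apply PDO.ext
  funext n
  rw [mul_coeff, mulCoeff, finsum_eq_single _ n fun i hi => by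
    rw [one_coeff, if_neg (by lia), sh_zero', mul_zero]]
  rw [one_coeff, sub_self, if_pos rfl, sh_one', mul_one]

theorem zero_mul' (A : PDO v) : 0 * A = 0 := by
  apply PDO.ext
  funext n
  simp [mul_coeff, mulCoeff, zero_coeff]

theorem mul_zero' (A : PDO v) : A * 0 = 0 := by
  apply PDO.ext
  funext n
  simp [mul_coeff, mulCoeff, zero_coeff, sh_zero']

instance : Ring (PDO v) where
  add_assoc _ _ _ := PDO.ext (add_assoc _ _ _)
  zero_add _ := PDO.ext (zero_add _)
  add_zero _ := PDO.ext (add_zero _)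
  add_comm _ _ := PDO.ext (add_comm _ _)
  neg_add_cancel _ := PDO.ext (neg_add_cancel _)
  mul_assoc := mul_assoc'
  one_mul := one_mul'
  mul_one := mul_one'
  left_distrib := left_distrib'
  right_distrib := right_distrib'
  zero_mul := zero_mul'
  mul_zero := mul_zero'
  nsmul := nsmulRec
  zsmul := zsmulRec

/-- The operator `∑_{k ≥ 0} s_k(m) x ^ k`. -/
def ofSeq (v : Lat) (s : ℕ → Coef) : PDO v :=
  ⟨fun j => if 0 ≤ j then s j.toNat else 0, 0, fun j hj => if_neg (by lia)⟩

/-- The coefficients of the left inverse of `∑_{k ≥ 0} s_k x ^ k`. -/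
def invSeq (v : Lat) (s : ℕ → Coef) (n : ℕ) : Coef :=
  ((if n = 0 then 1 else 0) - ∑ i : Fin n, invSeq v s i * sh v (i : ℕ) (s (n - i))) *
    (sh v n (s 0))⁻¹
termination_by n
decreasing_by exact i.2

theorem sh_mul_inv (n : ℤ) (f : Coef) (h : ∀ m, f m ≠ 0) : (sh v n f)⁻¹ * sh v n f = 1 := by
  funext m
  exact inv_mul_cancel₀ (h _)

theorem ofSeq_coeff (s : ℕ → Coef) (j : ℤ) :
    (ofSeq v s).coeff j = if 0 ≤ j then s j.toNat else 0 := rfl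

theorem invSeq_mul (s : ℕ → Coef) (h : ∀ m, s 0 m ≠ 0) :
    ofSeq v (invSeq v s) * ofSeq v s = 1 := by
  have h0 : ∀ t : ℕ → Coef, ∀ j < 0, (ofSeq v t).coeff j = 0 := fun t j hj => if_neg (by lia)
  apply PDO.ext
  funext n
  rw [mul_coeff, one_coeff]
  by_cases hn : n < 0
  · rw [mulCoeff_lt (h0 _) (h0 _) n (by lia), if_neg (by lia)]
  lift n to ℕ using not_lt.mp hn
  rw [mulCoeff_eq (h0 _) (h0 _) n ((Finset.range (n + 1)).map Nat.castEmbedding) (by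
    intro i hi
    rw [Finset.mem_Icc] at hi
    rw [Finset.mem_map]
    exact ⟨i.toNat, Finset.mem_range.mpr (by lia), by simp [hi.1]⟩)]
  rw [Finset.sum_map, Finset.sum_range_succ]
  have h1 : ∀ i ∈ Finset.range n, (ofSeq v (invSeq v s)).coeff (Nat.castEmbedding i) *
      sh v (Nat.castEmbedding i) ((ofSeq v s).coeff (n - Nat.castEmbedding i)) =
      invSeq v s i * sh v i (s (n - i)) := by
    intro i hi
    rw [Finset.mem_range] at hi
    rw [Nat.castEmbedding_apply, ofSeq_coeff, ofSeq_coeff, if_pos (by lia), if_pos (by lia),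
      Int.toNat_natCast, show ((n : ℤ) - i).toNat = n - i by lia]
  rw [Finset.sum_congr rfl h1, Nat.castEmbedding_apply, ofSeq_coeff, ofSeq_coeff,
    if_pos (by lia), if_pos (by lia), Int.toNat_natCast, sub_self, Int.toNat_zero,
    invSeq, mul_assoc, sh_mul_inv _ _ h, mul_one, Finset.sum_range]
  simp

theorem invSeq_zero_ne (s : ℕ → Coef) (h : ∀ m, s 0 m ≠ 0) (m : Lat) : invSeq v s 0 m ≠ 0 := by
  have h1 : invSeq v s 0 = (sh v 0 (s 0))⁻¹ := by
    rw [invSeq]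
    simp
  rw [h1]
  exact inv_ne_zero (h _)

/-- A series with nowhere vanishing leading coefficient is invertible. -/
theorem isUnit_ofSeq (s : ℕ → Coef) (h : ∀ m, s 0 m ≠ 0) : IsUnit (ofSeq v s) := by
  have h1 := invSeq_mul (v := v) s h
  have h2 := invSeq_mul (v := v) (invSeq v s) (invSeq_zero_ne s h)
  have h3 := left_inv_eq_right_inv h2 h1
  rw [h3] at h2
  exact ⟨⟨_, _, h2, h1⟩, rfl⟩

/-- The part of `A = ∑ a_j x ^ j` with `j ≤ n`, a difference operator. -/
def partLE (A : PDO v) (n : ℤ) : DiffOp :=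
  ∑ᶠ j : ℤ, if j ≤ n then term (A.coeff j) (j • v) else 0

/-- The coefficient of `Δ ^ p` in the expansion of `A = ∑ a_j x ^ j` in powers of `Δ = x⁻¹ - 1`,
obtained from `x ^ (-i) = (Δ + 1) ^ i = ∑_{j ≥ 0} (i choose j) Δ ^ (i - j)` for `i ∈ ℤ`. -/
def deltaCoeff (A : PDO v) (p : ℤ) : Coef :=
  ∑ᶠ j : ℕ, (Ring.choose (p + j) j : ℤ) • A.coeff (-(p + j))

/-- The part of `A` with powers `≥ 1` with respect to `Δ = x⁻¹ - 1`, a difference operator. -/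
def deltaPartPos (A : PDO v) : DiffOp :=
  ∑ᶠ p : ℕ, if 1 ≤ p then term (A.deltaCoeff p) 0 * (term 1 (-v) - 1) ^ p else 0

end PDO

/-! ### Wave operators and Lax operators -/

/-- The coefficient of `y_i ^ k` in `f_m (t - [y_i]_i) / τ_m (t)`. -/
def waveCoeff (i : Fin 3) (f τ : Lat → Ser Var) (k : ℕ) : Coef := fun m =>
  algebraMap (Ser Var) TField (miwaCoeff (-1) i k (f m)) / algebraMap (Ser Var) TField (τ m)

/-- `S₁ (Λ₁)`, a series in `x = Λ₁⁻¹`, with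
`S₁ exp (ξ (t^{(1)}, Λ₁)) (z ^ m₁) = Ψ₁`. -/
def S1 (τ : Lat → Ser Var) : PDO (-1, 0) :=
  PDO.ofSeq _ (waveCoeff 0 τ τ)

/-- `S₂ (Λ₂)`, a series in `x = Λ₂`, with
`S₂ exp (ξ (t^{(2)}, Λ₂⁻¹)) (z ^ m₂) = Ψ₂`. -/
def S2 (τ : Lat → Ser Var) : PDO (0, 1) :=
  PDO.ofSeq _ (waveCoeff 1 (fun m => τ (m + (1, 1))) τ)

/-- The coefficients of the wave operator `S₃`. -/
def s3 (τ : Lat → Ser Var) (k : ℕ) : Coef := fun m =>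
  (-1) ^ m.2 * waveCoeff 2 (fun m => τ (m + (1, 0))) τ k m

/-- `S₃ (Λ₁)`, a series in `x = Λ₁`, with
`S₃ exp (ξ (t^{(3)}, Λ₁⁻¹)) (z ^ (m₁ - m₂)) = Ψ₃`. -/
def S3 (τ : Lat → Ser Var) : PDO (1, 0) := PDO.ofSeq _ (s3 τ)

/-- `S₃ (Λ₂⁻¹)`: the same coefficients as `S₃ (Λ₁)`, with `x = Λ₂⁻¹`. -/
def S3' (τ : Lat → Ser Var) : PDO (0, -1) := PDO.ofSeq _ (s3 τ)

theorem miwaCoeff_zero (ε : ℂ) (i : Fin 3) (f : Ser Var) : miwaCoeff ε i 0 f = f := by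
  funext d
  rw [miwaCoeff, finsum_eq_single _ 0 fun e he => if_neg fun h => he ?_]
  · simp
    rfl
  · ext k
    by_contra hk
    have h1 := (Finset.sum_eq_zero_iff.mp h) k (Finsupp.mem_support_iff.mpr hk)
    simp only [mul_eq_zero, PNat.ne_zero, or_false] at h1
    exact hk h1

theorem waveCoeff_zero_ne (i : Fin 3) (f τ : Lat → Ser Var) (hf : ∀ m, f m ≠ 0)
    (hτ : ∀ m, τ m ≠ 0) (m : Lat) : waveCoeff i f τ 0 m ≠ 0 := by
  have hinj := IsFractionRing.injective (Ser Var) TField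
  rw [waveCoeff, miwaCoeff_zero]
  exact div_ne_zero ((map_ne_zero_iff _ hinj).mpr (hf m)) ((map_ne_zero_iff _ hinj).mpr (hτ m))

/-- The wave operators are invertible, so that `Ring.inverse` below is the actual inverse. -/
theorem isUnit_wave (τ : Lat → Ser Var) (hτ : ∀ m, τ m ≠ 0) :
    IsUnit (S1 τ) ∧ IsUnit (S2 τ) ∧ IsUnit (S3 τ) ∧ IsUnit (S3' τ) := by
  have h3 : ∀ m, s3 τ 0 m ≠ 0 := fun m =>
    mul_ne_zero (zpow_ne_zero _ (neg_ne_zero.mpr one_ne_zero))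
      (waveCoeff_zero_ne 2 _ τ (fun _ => hτ _) hτ m)
  exact ⟨PDO.isUnit_ofSeq _ (waveCoeff_zero_ne 0 τ τ hτ hτ),
    PDO.isUnit_ofSeq _ (waveCoeff_zero_ne 1 _ τ (fun _ => hτ _) hτ),
    PDO.isUnit_ofSeq _ h3, PDO.isUnit_ofSeq _ h3⟩

/-- The dressed operator `S x⁻¹ S⁻¹`. -/
def dress {v : Lat} (S : PDO v) : PDO v := S * PDO.mono v (-1) 1 * Ring.inverse S

/-- `L₁ (Λ₁) = S₁ Λ₁ S₁⁻¹`. -/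
def L1 (τ : Lat → Ser Var) : PDO (-1, 0) := dress (S1 τ)

/-- `L₂ (Λ₂) = S₂ Λ₂⁻¹ S₂⁻¹`. -/
def L2 (τ : Lat → Ser Var) : PDO (0, 1) := dress (S2 τ)

/-- `L₃ (Λ₁) = S₃ (Λ₁) Λ₁⁻¹ S₃ (Λ₁)⁻¹`. -/
def L3 (τ : Lat → Ser Var) : PDO (1, 0) := dress (S3 τ)

/-- `L₃ (Λ₂⁻¹) = S₃ (Λ₂⁻¹) Λ₂ S₃ (Λ₂⁻¹)⁻¹`. -/
def L3' (τ : Lat → Ser Var) : PDO (0, -1) := dress (S3' τ)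

/-- `B_k^{(1)} (Λ₁)`, the part of `L₁ ^ k` with nonnegative powers of `Λ₁ = x⁻¹`. -/
def B1 (τ : Lat → Ser Var) (k : ℕ) : DiffOp := (L1 τ ^ k).partLE 0

/-- `B_k^{(2)} (Λ₂)`, the part of `L₂ ^ k` with powers `≥ 1` of `Δ₂^* = Λ₂⁻¹ - 1`. -/
def B2 (τ : Lat → Ser Var) (k : ℕ) : DiffOp := (L2 τ ^ k).deltaPartPos

/-- `B_k^{(3)} (Λ₁)`, the part of `L₃ (Λ₁) ^ k` with negative powers of `Λ₁ = x`. -/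
def B3 (τ : Lat → Ser Var) (k : ℕ) : DiffOp := (L3 τ ^ k).partLE (-1)

/-- `B_k^{(3)} (Λ₂⁻¹)`, the part of `L₃ (Λ₂⁻¹) ^ k` with powers `≥ 1` of `Δ₂ = Λ₂ - 1`. -/
def B3' (τ : Lat → Ser Var) (k : ℕ) : DiffOp := (L3' τ ^ k).deltaPartPos

/-- `𝓛 = B_{n₁}^{(1)} (Λ₁) + B_{n₂}^{(2)} (Λ₂) + B_{n₃}^{(3)} (Λ₁)`. -/
def laxOp (n₁ n₂ n₃ : ℕ) (τ : Lat → Ser Var) : DiffOp := B1 τ n₁ + B2 τ n₂ + B3 τ n₃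

/-- `𝓛̃ = B_{n₁}^{(1)} (Λ₁) + B_{n₂}^{(2)} (Λ₂) + B_{n₃}^{(3)} (Λ₂⁻¹)`. -/
def laxOp' (n₁ n₂ n₃ : ℕ) (τ : Lat → Ser Var) : DiffOp := B1 τ n₁ + B2 τ n₂ + B3' τ n₃

end ThreeKP

end

/-! The bilinear equation is linear in the unprimed wave functions. The cases `l = 0` at all shifted
`m`, combined with the coefficients of a difference operator `D`, and the case `l = 1` give a
residue identity for the three defects `Φᵢ = D ψᵢ - z^{n₁} ψ₁`, resp. `z^{-n₂} ψ₂`, `z^{-n₃} ψ₃`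
(`IsKdVTau.residues_act`). Only the diagonal `t' = t` is needed: there the exponentials cancel, so
each `ψᵢ` and its dual become Laurent series in the local parameter `y = z⁻¹` or `y = z`, and the
remaining freedom is `m' ∈ ℤ²`.

The dual series have nonzero leading coefficients in degrees governed by `m'`. If the `Φᵢ` start
late enough, a suitable `m'` isolates the leading coefficient of one of them, so all vanish
(`eq_zero_of_residues`). The truncations in the Lax operators produce exactly these bounds. Each
part `B⁽ⁱ⁾` agrees with the full power of `Lᵢ` on `ψᵢ` up to late terms, and `Lᵢ^k` acts there as
multiplication by `y^{-k}` by dressing; on the other two wave functions it produces late terms only.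
The removal of the constant term in powers of `Δ` matters on `ψ₁`, whose leading coefficient is `1`
for every `m`: the differences `x^j - 1` cancel it.

The exponential factor returns at the end: the eigenvalue equation is a linear relation with
coefficients free of `z`, and such relations survive multiplication by a fixed exponential series
(`act_wave_of_act_bareWave`). -/

noncomputable section

namespace ThreeKP

/-! ### Multiplication by exponential series -/

section Exponential

variable {ι : Type}

/-- The weight of a monomial. -/
def expWeight (w : ι → ℤ) (d : ι →₀ ℕ) : ℤ := d.sum fun s a => (a : ℤ) * w s

theorem expWeight_zero (w : ι → ℤ) : expWeight w 0 = 0 := Finsupp.sum_zero_index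

theorem coeff_zExp (c : ι → ℂ) (w : ι → ℤ) (k : ℤ) (d : ι →₀ ℕ) :
    MvPowerSeries.coeff d (zExp c w k) =
      if expWeight w d = k then d.prod fun s a => c s ^ a / (a.factorial : ℂ) else 0 := rfl

open Classical in
/-- The exponents of `z` occurring in an exponential series up to degree `d`. -/
def expWeights (w : ι → ℤ) (d : ι →₀ ℕ) : Finset ℤ :=
  (Finset.HasAntidiagonal.antidiagonal d).image fun p => expWeight w p.1

theorem mem_expWeights {w : ι → ℤ} {d : ι →₀ ℕ} {k : ℤ} :
    k ∈ expWeights w d ↔ ∃ e ≤ d, expWeight w e = k := by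
  classical
  simp only [expWeights, Finset.mem_image, Finset.HasAntidiagonal.mem_antidiagonal]
  constructor
  · rintro ⟨p, hp, rfl⟩
    exact ⟨p.1, hp ▸ le_self_add, rfl⟩
  · rintro ⟨e, he, rfl⟩
    exact ⟨(e, d - e), add_tsub_cancel_of_le he, rfl⟩

theorem expWeights_mono {w : ι → ℤ} {d e : ι →₀ ℕ} (h : d ≤ e) :
    expWeights w d ⊆ expWeights w e := by
  intro k hk
  obtain ⟨x, hx, rfl⟩ := mem_expWeights.mp hk
  exact mem_expWeights.mpr ⟨x, hx.trans h, rfl⟩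

theorem coeff_zExp_mul_eq_zero (c : ι → ℂ) (w : ι → ℤ) {k : ℤ} {d : ι →₀ ℕ}
    (hk : k ∉ expWeights w d) (f : Ser ι) : MvPowerSeries.coeff d (zExp c w k * f) = 0 := by
  classical
  rw [MvPowerSeries.coeff_mul]
  refine Finset.sum_eq_zero fun p hp => ?_
  rw [coeff_zExp, if_neg, zero_mul]
  rintro rfl
  exact hk (mem_expWeights.mpr
    ⟨p.1, Finset.HasAntidiagonal.mem_antidiagonal.mp hp ▸ le_self_add, rfl⟩)

/-- In a fixed degree `d` the exponential involves finitely many powers of `z`, whatever `F` is. The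
set `K` may be larger than necessary, so that one `K` can serve several degrees. -/
theorem coeff_zMul_zExp (c : ι → ℂ) (w : ι → ℤ) {K : Finset ℤ} {d : ι →₀ ℕ}
    (hK : expWeights w d ⊆ K) (F : ℤ → Ser ι) (n : ℤ) :
    MvPowerSeries.coeff d (zMul (zExp c w) F n) =
      MvPowerSeries.coeff d (∑ k ∈ K, zExp c w k * F (n - k)) := by
  rw [map_sum]
  change (∑ᶠ k : ℤ, MvPowerSeries.coeff d (zExp c w k * F (n - k))) = _
  refine finsum_eq_sum_of_support_subset _ fun k hk => hK ?_
  by_contra h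
  exact hk (coeff_zExp_mul_eq_zero c w h _)

theorem zMul_zPow {f F : ℤ → Ser ι} (N : ℤ) : zMul f (zPow N F) = zPow N (zMul f F) := by
  funext n d
  simp only [zMul, zPow, sub_right_comm]

/-- Multiplication by an exponential series preserves linear relations. -/
theorem sum_mul_zMul_zExp_eq_zero {κ : Type*} (c : ι → ℂ) (w : ι → ℤ) (s : Finset κ)
    (b : κ → Ser ι) (F : κ → ℤ → Ser ι) (h : ∀ n, ∑ v ∈ s, b v * F v n = 0) (n : ℤ) :
    ∑ v ∈ s, b v * zMul (zExp c w) (F v) n = 0 := by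
  classical
  ext d
  -- The products with `b v` involve all degrees below `d`; the exponents for `d` cover them all.
  have hK : ∀ p ∈ Finset.HasAntidiagonal.antidiagonal d,
      expWeights w p.2 ⊆ expWeights w d := fun p hp =>
    expWeights_mono (Finset.HasAntidiagonal.mem_antidiagonal.mp hp ▸ le_add_self)
  set K := expWeights w d
  have h1 : ∑ v ∈ s, b v * ∑ k ∈ K, zExp c w k * F v (n - k) = 0 := by
    simp_rw [Finset.mul_sum]
    rw [Finset.sum_comm]
    refine Finset.sum_eq_zero fun k _ => ?_
    rw [← mul_zero (zExp c w k), ← h (n - k), Finset.mul_sum]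
    exact Finset.sum_congr rfl fun v _ => by ring
  rw [← h1, map_sum, map_sum]
  refine Finset.sum_congr rfl fun v _ => ?_
  rw [MvPowerSeries.coeff_mul, MvPowerSeries.coeff_mul]
  exact Finset.sum_congr rfl fun p hp => by rw [coeff_zMul_zExp c w (hK p hp)]

/-- Multiplication by an exponential series preserves linear relations over the fractions. -/
theorem sum_mul_algebraMap_zMul_zExp_eq_zero {κ : Type*} (c : Var → ℂ) (w : Var → ℤ)
    (s : Finset κ) (b : κ → TField) (F : κ → ℤ → Ser Var)
    (h : ∀ n, ∑ v ∈ s, b v * algebraMap (Ser Var) TField (F v n) = 0) (n : ℤ) :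
    ∑ v ∈ s, b v * algebraMap (Ser Var) TField (zMul (zExp c w) (F v) n) = 0 := by
  -- Clearing a common denominator `q` reduces to coefficients in the power series ring.
  obtain ⟨q, hq⟩ := IsLocalization.exist_integer_multiples (nonZeroDivisors (Ser Var)) s b
  choose! a ha using hq
  have hinj := IsFractionRing.injective (Ser Var) TField
  have hq0 : algebraMap (Ser Var) TField q ≠ 0 :=
    (map_ne_zero_iff _ hinj).mpr (nonZeroDivisors.ne_zero q.2)
  have key : ∀ G : κ → Ser Var, algebraMap (Ser Var) TField (∑ v ∈ s, a v * G v) =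
      algebraMap (Ser Var) TField q * ∑ v ∈ s, b v * algebraMap (Ser Var) TField (G v) := by
    intro G
    rw [map_sum, Finset.mul_sum]
    refine Finset.sum_congr rfl fun v hv => ?_
    rw [map_mul, ha v hv, Algebra.smul_def, mul_assoc]
  have h2 := sum_mul_zMul_zExp_eq_zero c w s a F fun n => by
    apply hinj
    rw [key, h, mul_zero, map_zero]
  have h3 := key fun v => zMul (zExp c w) (F v) n
  rw [h2 n, map_zero] at h3
  exact (mul_eq_zero.mp h3.symm).resolve_left hq0

end Exponential

/-! ### Action on wave functions without the exponential factor -/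

/-- The wave function `σ(m) z ^ N(m) f_m (t - [y_i]_i) / τ_m (t)` without the exponential. -/
def bareWave (i : Fin 3) (N : Lat → ℤ) (σ : Lat → TField) (f τ : Lat → Ser Var) :
    Lat → ℤ → TField :=
  fun m n => σ m * (algebraMap (Ser Var) TField (miwa (-1) i (f m) (n - N m)) /
    algebraMap (Ser Var) TField (τ m))

/-- An operator acts on a wave function in the way it acts on its non-exponential factor. -/
theorem act_wave_of_act_bareWave (D : DiffOp) (i : Fin 3) (N : Lat → ℤ) (σ : Lat → TField)
    (f τ : Lat → Ser Var) (M : ℤ)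
    (h : D.act (bareWave i N σ f τ) = fun m => zPow M (bareWave i N σ f τ m)) :
    D.act (fun m n => σ m * waveSer i (N m) (f m) (τ m) n) =
      fun m => zPow M fun n => σ m * waveSer i (N m) (f m) (τ m) n := by
  funext m n
  -- The index `none` carries the right-hand side, so the eigenvalue equation becomes a single
  -- vanishing linear combination.
  let b : Option (Multiplicative Lat) → TField := fun o => o.elim
    (-(σ m / algebraMap (Ser Var) TField (τ m)))
    (fun v => D.coeff v m * (σ (m + v.toAdd) / algebraMap (Ser Var) TField (τ (m + v.toAdd))))
  let F : Option (Multiplicative Lat) → ℤ → Ser Var := fun o => o.elim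
    (zPow M (zPow (N m) (miwa (-1) i (f m))))
    (fun v => zPow (N (m + v.toAdd)) (miwa (-1) i (f (m + v.toAdd))))
  have h1 := sum_mul_algebraMap_zMul_zExp_eq_zero
    (fun s => if s.1 = i then 1 else 0) (fun s => -locExp i * (s.2 : ℕ))
    (Finset.insertNone D.support) b F (fun n => by
      have h2 := congrFun (congrFun h m) n
      rw [DiffOp.act, SkewMonoidAlgebra.sum_def'] at h2
      rw [Finset.sum_insertNone]
      simp only [b, F, Option.elim_none, Option.elim_some]
      simp only [zPow, bareWave] at h2 ⊢
      rw [neg_mul, neg_add_eq_zero, div_mul_eq_mul_div, mul_div_assoc, ← h2]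
      exact Finset.sum_congr rfl fun v _ => by ring) n
  rw [Finset.sum_insertNone] at h1
  simp only [b, F, Option.elim_none, Option.elim_some, zMul_zPow] at h1
  rw [neg_mul, neg_add_eq_zero] at h1
  rw [DiffOp.act, SkewMonoidAlgebra.sum_def']
  simp only [waveSer, zPow, expXi] at h1 ⊢
  rw [← mul_div_assoc, ← div_mul_eq_mul_div, h1]
  exact Finset.sum_congr rfl fun v _ => by ring

/-! ### The diagonal `t' = t` -/

/-- Identifying `t'` with `t` is a legitimate substitution in infinitely many variables because each
time has only two preimages. -/
instance tendstoCofinite_fold : Filter.TendstoCofinite (Sum.elim id id : Var ⊕ Var → Var) := by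
  rw [Filter.tendstoCofinite_iff_finite_preimage_singleton]
  intro b
  refine (Set.toFinite ({Sum.inl b, Sum.inr b} : Set (Var ⊕ Var))).subset ?_
  rintro (x | x) h
  · exact Or.inl (congrArg Sum.inl h)
  · exact Or.inr (congrArg Sum.inr h)

/-- The specialization `t' = t`. -/
def diag : Ser (Var ⊕ Var) →ₐ[ℂ] Ser Var := MvPowerSeries.rename (Sum.elim id id)

theorem diag_inl (f : Ser Var) :
    diag (MvPowerSeries.rename Function.Embedding.inl f) = f := by
  rw [diag, MvPowerSeries.rename_rename]
  exact MvPowerSeries.rename_id_apply f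

theorem diag_inr (f : Ser Var) :
    diag (MvPowerSeries.rename Function.Embedding.inr f) = f := by
  rw [diag, MvPowerSeries.rename_rename]
  exact MvPowerSeries.rename_id_apply f

/-- Allows a replacement that is valid only on the finite fibre over `d`, such as a finite
truncation of a convolution in `z`. -/
theorem diag_coeff_congr {f g : Ser (Var ⊕ Var)} {d : Var →₀ ℕ}
    (h : ∀ x : Var ⊕ Var →₀ ℕ, x.mapDomain (Sum.elim id id) = d →
      MvPowerSeries.coeff x f = MvPowerSeries.coeff x g) :
    MvPowerSeries.coeff d (diag f) = MvPowerSeries.coeff d (diag g) := by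
  rw [diag, MvPowerSeries.coeff_rename, MvPowerSeries.coeff_rename]
  exact Finset.sum_congr rfl fun x hx => h x (by simpa using hx)

/-- `exp (∑ c_s x_s)`. -/
def expSer {ι : Type} (c : ι → ℂ) : Ser ι :=
  fun d => d.prod fun s a => c s ^ a / (a.factorial : ℂ)

theorem coeff_expSer {ι : Type} (c : ι → ℂ) (d : ι →₀ ℕ) :
    MvPowerSeries.coeff d (expSer c) = d.prod fun s a => c s ^ a / (a.factorial : ℂ) := rfl

/-- This is the Euler operator `x_s ∂/∂x_s` applied to the exponential, read off coefficientwise. -/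
theorem coeff_X_mul_expSer {ι : Type} (c : ι → ℂ) (s : ι) (d : ι →₀ ℕ) :
    MvPowerSeries.coeff d (MvPowerSeries.C (c s) * (MvPowerSeries.X s * expSer c)) =
      d s * MvPowerSeries.coeff d (expSer c) := by
  classical
  rw [MvPowerSeries.coeff_C_mul, MvPowerSeries.X, MvPowerSeries.coeff_monomial_mul]
  split_ifs with h
  · obtain ⟨e, rfl⟩ := exists_add_of_le h
    have h0 : ∀ i : ι, c i ^ 0 / (Nat.factorial 0 : ℂ) = 1 := by simp
    rw [add_tsub_cancel_left, coeff_expSer, coeff_expSer,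
      ← Finsupp.mul_prod_erase' e s (fun s (a : ℕ) => c s ^ a / (a.factorial : ℂ)) h0,
      ← Finsupp.mul_prod_erase' (Finsupp.single s 1 + e) s
        (fun s (a : ℕ) => c s ^ a / (a.factorial : ℂ)) h0, Finsupp.erase_add,
      Finsupp.erase_single, zero_add, Finsupp.add_apply, Finsupp.single_eq_same, add_comm 1 (e s),
      Nat.factorial_succ, pow_succ]
    push_cast
    have h1 : (e s : ℂ) + 1 ≠ 0 := Nat.cast_add_one_ne_zero _
    field_simp
  · have h0 : d s = 0 := by
      by_contra h0
      exact h (Finsupp.single_le_iff.mpr (Nat.one_le_iff_ne_zero.mpr h0))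
    rw [h0]
    simp

theorem mapDomain_fold (x : Var ⊕ Var →₀ ℕ) (s : Var) :
    x.mapDomain (Sum.elim id id : Var ⊕ Var → Var) s = x (Sum.inl s) + x (Sum.inr s) := by
  induction x using Finsupp.induction_linear with
  | zero => simp
  | add f g hf hg =>
    rw [Finsupp.mapDomain_add, Finsupp.add_apply, hf, hg]
    simp only [Finsupp.add_apply]
    ring
  | single a b =>
    rw [Finsupp.mapDomain_single]
    rcases a with a | a <;> simp [Finsupp.single_apply]

/-- `exp (∑ c_s (t_s - t'_s)) = 1` for `t' = t`. -/
theorem diag_expSer (c : Var → ℂ) : diag (expSer (Sum.elim c (-c))) = 1 := by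
  classical
  ext d
  rw [MvPowerSeries.coeff_one]
  split_ifs with hd
  · subst hd
    rw [MvPowerSeries.coeff_zero_eq_constantCoeff_apply, diag,
      MvPowerSeries.constantCoeff_rename, ← MvPowerSeries.coeff_zero_eq_constantCoeff_apply,
      coeff_expSer, Finsupp.prod_zero_index]
  · obtain ⟨s, hs⟩ := Finsupp.ne_iff.mp hd
    set u := expSer (Sum.elim c (-c))
    -- On the diagonal `c_s t_s - c_s t'_s` vanishes, while before specialization this factor
    -- multiplies the coefficients over `d` by `d s`. As `d s ≠ 0`, the coefficient at `d` is zero.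
    have h1 : diag (MvPowerSeries.C (Sum.elim c (-c) (Sum.inl s)) *
        (MvPowerSeries.X (Sum.inl s) * u) +
        MvPowerSeries.C (Sum.elim c (-c) (Sum.inr s)) * (MvPowerSeries.X (Sum.inr s) * u)) =
        0 := by
      simp only [diag, map_add, map_mul, MvPowerSeries.rename_C, MvPowerSeries.rename_X,
        Sum.elim_inl, Sum.elim_inr, Pi.neg_apply, map_neg, id_eq]
      ring
    have h2 := congrArg (MvPowerSeries.coeff d) h1
    rw [diag_coeff_congr (g := MvPowerSeries.C (d s : ℂ) * u), map_mul, diag,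
      MvPowerSeries.rename_C, MvPowerSeries.coeff_C_mul, map_zero] at h2
    · exact (mul_eq_zero.mp h2).resolve_left (Nat.cast_ne_zero.mpr hs)
    · rintro x rfl
      rw [map_add, coeff_X_mul_expSer, coeff_X_mul_expSer, MvPowerSeries.coeff_C_mul,
        mapDomain_fold]
      push_cast
      ring

theorem expWeight_fold (w : Var → ℤ) (x : Var ⊕ Var →₀ ℕ) :
    expWeight w (x.mapDomain (Sum.elim id id)) = expWeight (Sum.elim w w) x := by
  rw [expWeight, Finsupp.sum_mapDomain_index (by simp) (by intros; push_cast; ring)]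
  refine Finset.sum_congr rfl fun s _ => ?_
  rcases s with s | s <;> rfl

/-- The weight of a monomial depends only on its image under `t' = t`. Hence on each fibre the `z ^
k` coefficient is either the whole exponential or zero, and the whole exponential specializes to
`1`. -/
theorem diag_zExp (c : Var → ℂ) (w : Var → ℤ) (k : ℤ) :
    diag (zExp (Sum.elim c (-c)) (Sum.elim w w) k) = if k = 0 then 1 else 0 := by
  classical
  ext d
  rw [diag_coeff_congr (g := MvPowerSeries.C (if expWeight w d = k then (1 : ℂ) else 0) *
    expSer (Sum.elim c (-c)))]
  · rw [map_mul, diag_expSer, diag, MvPowerSeries.rename_C, mul_one, MvPowerSeries.coeff_C]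
    by_cases hd : d = 0
    · subst hd
      rw [expWeight_zero, if_pos rfl]
      by_cases hk : k = 0
      · simp [hk]
      · rw [if_neg (Ne.symm hk), if_neg hk, map_zero]
    · rw [if_neg hd]
      split_ifs
      · rw [MvPowerSeries.coeff_one, if_neg hd]
      · rw [map_zero]
  · rintro x rfl
    rw [MvPowerSeries.coeff_C_mul, coeff_zExp, expWeight_fold, coeff_expSer, ite_mul, one_mul,
      zero_mul]

theorem diag_zMul_zExp (c : Var → ℂ) (w : Var → ℤ) (F : ℤ → Ser (Var ⊕ Var)) (n : ℤ) :
    diag (zMul (zExp (Sum.elim c (-c)) (Sum.elim w w)) F n) = diag (F n) := by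
  classical
  ext d
  have hfin : {x : Var ⊕ Var →₀ ℕ | x.mapDomain (Sum.elim id id) = d}.Finite :=
    Filter.TendstoCofinite.finite_preimage_singleton
      (Finsupp.mapDomain (Sum.elim id id : Var ⊕ Var → Var)) d
  -- `K` serves the whole fibre over `d`; `0` is inserted because the term `k = 0` is the one that
  -- survives.
  let K : Finset ℤ := insert 0 (hfin.toFinset.biUnion (expWeights (Sum.elim w w)))
  rw [diag_coeff_congr (g := ∑ k ∈ K, zExp (Sum.elim c (-c)) (Sum.elim w w) k * F (n - k))]
  · simp_rw [map_sum, map_mul, diag_zExp, ite_mul, one_mul, zero_mul]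
    rw [← map_sum, Finset.sum_ite_eq', if_pos (Finset.mem_insert_self _ _), sub_zero]
  · intro x hx
    exact coeff_zMul_zExp _ _ ((Finset.subset_biUnion_of_mem (expWeights (Sum.elim w w))
      (hfin.mem_toFinset.mpr hx)).trans (Finset.subset_insert _ _)) F n

/-! ### Bilinear residues at `t' = t` -/

/-- The series `∑ f_j y ^ j` in `z`, where `y = z ^ s`. -/
def oneSided {A : Type} [Zero A] (s : ℤ) (f : ℕ → A) : ℤ → A :=
  fun n => if 0 ≤ s * n then f (s * n).toNat else 0

theorem zMul_oneSided {ι : Type} {s : ℤ} (hs : s * s = 1) (f g : ℕ → Ser ι) :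
    zMul (oneSided s f) (oneSided s g) =
      oneSided s fun N => ∑ p ∈ Finset.HasAntidiagonal.antidiagonal N, f p.1 * g p.2 := by
  funext n
  ext d
  change (∑ᶠ k : ℤ, MvPowerSeries.coeff d (oneSided s f k * oneSided s g (n - k))) = _
  have hinv : ∀ k : ℤ, s * (s * k) = k := fun k => by rw [← mul_assoc, hs, one_mul]
  have hinj : Function.Injective fun j : ℕ => s * (j : ℤ) := fun a b h => by
    have := congrArg (s * ·) h
    simpa only [hinv, Nat.cast_inj] using this
  rw [finsum_eq_sum_of_support_subset (s := (Finset.range ((s * n + 1).toNat)).map ⟨_, hinj⟩)]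
  · rw [Finset.sum_map, oneSided]
    split_ifs with h
    · obtain ⟨N, hN⟩ := Int.eq_ofNat_of_zero_le h
      rw [Finset.Nat.sum_antidiagonal_eq_sum_range_succ_mk, map_sum, hN, Int.toNat_natCast,
        show ((N : ℤ) + 1).toNat = N + 1 by lia]
      refine Finset.sum_congr rfl fun j hj => ?_
      rw [Finset.mem_range] at hj
      simp only [Function.Embedding.coeFn_mk, oneSided, mul_sub, hinv, hN]
      rw [if_pos (by lia), if_pos (by lia), Int.toNat_natCast, show ((N : ℤ) - j).toNat = N - j by
        lia]
    · rw [show (s * n + 1).toNat = 0 by lia, Finset.range_zero, Finset.sum_empty, map_zero]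
  · intro k hk
    have h1 : 0 ≤ s * k := by
      by_contra h
      exact hk (by simp [oneSided, h])
    have h2 : 0 ≤ s * (n - k) := by
      by_contra h
      exact hk (by simp [oneSided, h])
    rw [mul_sub] at h2
    simp only [Finset.coe_map, Set.mem_image, Finset.coe_range, Set.mem_Iio,
      Function.Embedding.coeFn_mk]
    exact ⟨(s * k).toNat, by lia, by rw [Int.toNat_of_nonneg h1, hinv]⟩

theorem locExp_mul_self (i : Fin 3) : locExp i * locExp i = 1 := by
  fin_cases i <;> rfl

theorem miwa_eq_oneSided (ε : ℂ) (i : Fin 3) (f : Ser Var) :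
    miwa ε i f = oneSided (locExp i) fun j => miwaCoeff ε i j f := rfl

theorem map_oneSided {A B F : Type} [Zero A] [Zero B] [FunLike F A B] [ZeroHomClass F A B]
    (φ : F) (s : ℤ) (f : ℕ → A) :
    (fun n => φ (oneSided s f n)) = oneSided s fun j => φ (f j) := by
  funext n
  rw [oneSided, oneSided, apply_ite φ, map_zero]

/-- The series `f (t + ε [y]_i)` in `y` over the field of fractions. -/
def miwaSer (ε : ℂ) (i : Fin 3) (f : Ser Var) : LaurentSeries TField :=
  HahnSeries.ofPowerSeries ℤ TField
    (PowerSeries.mk fun j => algebraMap (Ser Var) TField (miwaCoeff ε i j f))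

theorem coeff_ofPowerSeries {R : Type*} [CommRing R] (f : PowerSeries R) (n : ℤ) :
    (HahnSeries.ofPowerSeries ℤ R f).coeff n =
      if 0 ≤ n then PowerSeries.coeff n.toNat f else 0 := by
  split_ifs with h
  · lift n to ℕ using h
    exact HahnSeries.ofPowerSeries_apply_coeff f n
  · rw [HahnSeries.ofPowerSeries_apply]
    refine HahnSeries.embDomain_of_notMem_range ?_
    rintro ⟨k, rfl⟩
    exact h (by simp)

/-- The bilinear residues at `t' = t` are coefficients of products of series in `y`. -/
theorem algebraMap_diag_bilinearRes (i : Fin 3) (N : ℤ) (f g : Ser Var) :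
    algebraMap (Ser Var) TField (diag (bilinearRes i N f g)) =
      (miwaSer (-1) i f * miwaSer 1 i g).coeff (locExp i * (-1 - N)) := by
  have h1 : (fun s : Var => if s.1 = i then (-1 : ℂ) else 0) =
      -fun s : Var => if s.1 = i then (1 : ℂ) else 0 := by
    funext s
    simp only [Pi.neg_apply]
    split_ifs <;> simp
  rw [bilinearRes, expXiDiff, h1, zPow, diag_zMul_zExp]
  simp only [miwa_eq_oneSided]
  rw [map_oneSided, map_oneSided, zMul_oneSided (locExp_mul_self i)]
  rw [miwaSer, miwaSer, ← map_mul, coeff_ofPowerSeries, oneSided]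
  split_ifs with h
  · rw [PowerSeries.coeff_mul, map_sum, map_sum]
    refine Finset.sum_congr rfl fun p _ => ?_
    rw [map_mul, diag_inl, diag_inr, map_mul, PowerSeries.coeff_mk, PowerSeries.coeff_mk]
  · rw [map_zero, map_zero]

/-! ### Parts of pseudo-difference operators as finite sums -/

theorem term_add (a b : Coef) (v : Lat) : term (a + b) v = term a v + term b v :=
  SkewMonoidAlgebra.single_add _ _ _

theorem term_zero (v : Lat) : term 0 v = 0 := SkewMonoidAlgebra.single_zero _

theorem term_sum {κ : Type*} (s : Finset κ) (a : κ → Coef) (v : Lat) :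
    term (∑ i ∈ s, a i) v = ∑ i ∈ s, term (a i) v :=
  map_sum (SkewMonoidAlgebra.singleAddHom (Multiplicative.ofAdd v)) a s

theorem term_natCast_mul (n : ℕ) (a : Coef) (v : Lat) : term (n * a) v = n * term a v := by
  induction n with
  | zero => rw [Nat.cast_zero, Nat.cast_zero, zero_mul, zero_mul, term_zero]
  | succ n ih =>
    rw [Nat.cast_succ, Nat.cast_succ, add_mul, add_mul, one_mul, one_mul, term_add, ih]

theorem zsmul_coef (z : ℤ) (a : Coef) : z • a = (z : Coef) * a := by
  funext m
  change z • a m = (z : Coef) m * a m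
  rw [Pi.intCast_apply]
  induction z using Int.induction_on with
  | zero => rw [zero_smul, Int.cast_zero, zero_mul]
  | succ n ih => rw [add_smul, ih, one_smul, Int.cast_add, Int.cast_one, add_mul, one_mul]
  | pred n ih => rw [sub_smul, ih, one_smul, Int.cast_sub, Int.cast_one, sub_mul, one_mul]

theorem term_mul_term_one (a : Coef) (v w : Lat) : term a v * term 1 w = term a (v + w) := by
  rw [term, term, SkewMonoidAlgebra.single_mul_single, smul_one, mul_one, ← ofAdd_add, ← term]

theorem term_one_zero : term 1 0 = 1 := rfl

theorem term_one_pow (v : Lat) (n : ℕ) : term 1 v ^ n = term 1 (n • v) := by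
  induction n with
  | zero => rw [pow_zero, zero_smul, term_one_zero]
  | succ n ih => rw [pow_succ, ih, term_mul_term_one, succ_nsmul]

namespace PDO

variable {v : Lat}

theorem partLE_eq_sum (A : PDO v) {M : ℤ} (hM : ∀ j < M, A.coeff j = 0) (n : ℤ) :
    A.partLE n = ∑ j ∈ Finset.Icc M n, term (A.coeff j) (j • v) := by
  rw [partLE, finsum_eq_sum_of_support_subset (s := Finset.Icc M n)]
  · exact Finset.sum_congr rfl fun j hj => if_pos (Finset.mem_Icc.mp hj).2
  · intro j hj
    rw [Finset.coe_Icc, Set.mem_Icc]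
    by_contra h
    apply hj
    by_cases hn : j ≤ n
    · simp only [if_pos hn]
      rw [hM j (by lia), term_zero]
    · exact if_neg hn

/-- With `i = p + j` the binomial becomes `i.choose p`, which vanishes for `i < p`; the range of
summation can thus be independent of `p`. -/
theorem deltaCoeff_eq_sum (A : PDO v) {N : ℕ} (hN : ∀ j < -(N : ℤ), A.coeff j = 0) (p : ℕ) :
    A.deltaCoeff p = ∑ i ∈ Finset.range (N + 1), (i.choose p : Coef) * A.coeff (-(i : ℤ)) := by
  have h1 : ∑ i ∈ Finset.range (N + 1), (i.choose p : Coef) * A.coeff (-(i : ℤ)) =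
      ∑ i ∈ Finset.Ico p (N + 1), (i.choose p : Coef) * A.coeff (-(i : ℤ)) := by
    symm
    refine Finset.sum_subset (fun i hi => ?_) fun i hi hi' => ?_
    · rw [Finset.mem_Ico] at hi
      exact Finset.mem_range.mpr hi.2
    · rw [Finset.mem_range] at hi
      rw [Finset.mem_Ico] at hi'
      rw [Nat.choose_eq_zero_of_lt (by lia), Nat.cast_zero, zero_mul]
  rw [h1, Finset.sum_Ico_eq_sum_range, deltaCoeff,
    finsum_eq_sum_of_support_subset (s := Finset.range (N + 1 - p))]
  · refine Finset.sum_congr rfl fun j _ => ?_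
    rw [← Nat.cast_add, Ring.choose_natCast, zsmul_coef, Int.cast_natCast, ← Nat.choose_symm_add]
  · intro j hj
    rw [Finset.coe_range, Set.mem_Iio]
    by_contra h
    apply hj
    simp only
    rw [hN _ (by lia), zsmul_coef, mul_zero]

/-- Positive powers of `x` expand into negative powers of `Δ` only. For `i ≥ 0`, `x⁻ⁱ = (Δ + 1)ⁱ` is
a polynomial with constant term `1`, so discarding `Δ⁰` leaves `x⁻ⁱ - 1`. -/
theorem deltaPartPos_eq_sum (A : PDO v) {N : ℕ} (hN : ∀ j < -(N : ℤ), A.coeff j = 0) :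
    A.deltaPartPos = ∑ i ∈ Finset.range (N + 1),
      (term (A.coeff (-(i : ℤ))) (-(i : ℤ) • v) - term (A.coeff (-(i : ℤ))) 0) := by
  set X : DiffOp := term 1 (-v)
  have hbin : ∀ i ∈ Finset.range (N + 1),
      ∑ p ∈ Finset.range (N + 1), (i.choose p : DiffOp) * (X - 1) ^ p = X ^ i := by
    intro i hi
    rw [Finset.mem_range] at hi
    conv_rhs => rw [← sub_add_cancel X 1, (Commute.one_right (X - 1)).add_pow]
    simp only [one_pow, mul_one, Nat.cast_comm]
    symm
    refine Finset.sum_subset (Finset.range_mono (by lia)) fun p _ hp => ?_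
    rw [Finset.mem_range] at hp
    rw [Nat.choose_eq_zero_of_lt (by lia), Nat.cast_zero, mul_zero]
  have hall : ∑ p ∈ Finset.range (N + 1), term (A.deltaCoeff p) 0 * (X - 1) ^ p =
      ∑ i ∈ Finset.range (N + 1), term (A.coeff (-(i : ℤ))) (-(i : ℤ) • v) := by
    simp only [deltaCoeff_eq_sum A hN, term_sum, Finset.sum_mul]
    rw [Finset.sum_comm]
    refine Finset.sum_congr rfl fun i hi => ?_
    rw [show -(i : ℤ) • v = 0 + i • (-v) by simp, ← term_mul_term_one, ← term_one_pow,
      ← hbin i hi, Finset.mul_sum]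
    refine Finset.sum_congr rfl fun p _ => ?_
    rw [term_natCast_mul, ← mul_assoc, Nat.cast_comm]
  have hzero : term (A.deltaCoeff 0) 0 =
      ∑ i ∈ Finset.range (N + 1), term (A.coeff (-(i : ℤ))) 0 := by
    have := deltaCoeff_eq_sum A hN 0
    rw [Nat.cast_zero] at this
    rw [this, ← term_sum]
    simp only [Nat.choose_zero_right, Nat.cast_one, one_mul]
  rw [Finset.sum_sub_distrib, ← hall, ← hzero, deltaPartPos,
    finsum_eq_sum_of_support_subset (s := Finset.range (N + 1)), Finset.sum_range_succ',
    Finset.sum_range_succ']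
  · simp
    rfl
  · intro p hp
    rw [Finset.coe_range, Set.mem_Iio]
    by_contra h
    apply hp
    simp only
    rw [deltaCoeff_eq_sum A hN, Finset.sum_eq_zero, term_zero, zero_mul, ite_self]
    intro i hi
    rw [Finset.mem_range] at hi
    rw [Nat.choose_eq_zero_of_lt (by lia), Nat.cast_zero, zero_mul]

theorem exists_neg_bound (A : PDO v) : ∃ N : ℕ, ∀ j < -(N : ℤ), A.coeff j = 0 := by
  obtain ⟨M, hM⟩ := A.bddBelow
  exact ⟨(-M).toNat, fun j hj => hM j (by lia)⟩

theorem mul_mono_pow_coeff (A : PDO v) (k : ℕ) (j : ℤ) :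
    (A * mono v (-1) 1 ^ k).coeff j = A.coeff (j + k) := by
  induction k generalizing j with
  | zero => rw [pow_zero, mul_one, Nat.cast_zero, add_zero]
  | succ k ih =>
    rw [pow_succ, ← mul_assoc, mul_coeff, mulCoeff, finsum_eq_single _ (j + 1)]
    · rw [ih]
      simp only [mono]
      rw [if_pos (by lia), sh_one', mul_one]
      congr 1
      push_cast
      ring
    · intro i hi
      simp only [mono]
      rw [if_neg (by lia), sh_zero', mul_zero]

theorem dress_pow_mul {S : PDO v} (hS : IsUnit S) (k : ℕ) :
    dress S ^ k * S = S * mono v (-1) 1 ^ k := by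
  induction k with
  | zero => rw [pow_zero, pow_zero, one_mul, mul_one]
  | succ k ih =>
    rw [pow_succ, mul_assoc, dress, mul_assoc (S * _), Ring.inverse_mul_cancel S hS, mul_one,
      ← dress, ← mul_assoc, ih, mul_assoc, ← pow_succ]

end PDO

/-! ### Families of Laurent series -/

/-- The action of difference operators on families of Laurent series. -/
def actAt (ψ : Lat → LaurentSeries TField) (m : Lat) : DiffOp →+ LaurentSeries TField :=
  AddMonoidHom.mk' (fun D => D.sum fun v a => HahnSeries.C (a m) * ψ (m + v.toAdd)) fun A B =>
    SkewMonoidAlgebra.sum_add_index' (fun _ => by rw [Pi.zero_apply, map_zero, zero_mul])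
      fun _ _ _ => by rw [Pi.add_apply, map_add, add_mul]

theorem actAt_term (ψ : Lat → LaurentSeries TField) (m : Lat) (a : Coef) (v : Lat) :
    actAt ψ m (term a v) = HahnSeries.C (a m) * ψ (m + v) :=
  SkewMonoidAlgebra.sum_single_index (h := fun (v : Multiplicative Lat) (a : Coef) =>
    HahnSeries.C (a m) * ψ (m + v.toAdd)) (by rw [Pi.zero_apply, map_zero, zero_mul])

theorem actAt_eq_sum (ψ : Lat → LaurentSeries TField) (m : Lat) (D : DiffOp) :
    actAt ψ m D = ∑ v ∈ D.support, HahnSeries.C (D.coeff v m) * ψ (m + v.toAdd) :=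
  SkewMonoidAlgebra.sum_def' D fun (v : Multiplicative Lat) (a : Coef) =>
    HahnSeries.C (a m) * ψ (m + v.toAdd)

theorem coeff_C_mul (a : TField) (f : LaurentSeries TField) (n : ℤ) :
    (HahnSeries.C a * f).coeff n = a * f.coeff n := by
  rw [HahnSeries.C_apply, HahnSeries.coeff_single_zero_mul]

/-- The series `f` has no terms of degree less than `c`. -/
def VanishesBelow (c : ℤ) (f : LaurentSeries TField) : Prop := ∀ n < c, f.coeff n = 0

namespace VanishesBelow

variable {c : ℤ} {f g : LaurentSeries TField}

theorem mono {c' : ℤ} (hf : VanishesBelow c f) (h : c' ≤ c) : VanishesBelow c' f :=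
  fun n hn => hf n (by lia)

theorem add (hf : VanishesBelow c f) (hg : VanishesBelow c g) : VanishesBelow c (f + g) :=
  fun n hn => by rw [HahnSeries.coeff_add, hf n hn, hg n hn, add_zero]

theorem sub (hf : VanishesBelow c f) (hg : VanishesBelow c g) : VanishesBelow c (f - g) :=
  fun n hn => by rw [HahnSeries.coeff_sub, hf n hn, hg n hn, sub_zero]

theorem C_mul (a : TField) (hf : VanishesBelow c f) :
    VanishesBelow c (HahnSeries.C a * f) :=
  fun n hn => by rw [coeff_C_mul, hf n hn, mul_zero]

theorem sum {κ : Type*} {s : Finset κ} {F : κ → LaurentSeries TField}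
    (h : ∀ i ∈ s, VanishesBelow c (F i)) : VanishesBelow c (∑ i ∈ s, F i) :=
  fun n hn => by rw [HahnSeries.coeff_sum]; exact Finset.sum_eq_zero fun i hi => h i hi n hn

theorem coeff_mul_add {c' : ℤ} (hf : VanishesBelow c f) (hg : VanishesBelow c' g) :
    (f * g).coeff (c + c') = f.coeff c * g.coeff c' := by
  rw [HahnSeries.coeff_mul]
  have h : ∀ p ∈ Finset.antidiagonal f.isPWO_support g.isPWO_support (c + c'),
      p ≠ (c, c') → f.coeff p.1 * g.coeff p.2 = 0 := by
    intro p hp hne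
    rw [Finset.mem_antidiagonal] at hp
    obtain ⟨_, _, h3⟩ := hp
    rcases lt_trichotomy p.1 c with h | h | h
    · rw [hf _ h, zero_mul]
    · exact absurd (Prod.ext h (by simp only; lia)) hne
    · rw [hg _ (by lia), mul_zero]
  by_cases hmem : (c, c') ∈ Finset.antidiagonal f.isPWO_support g.isPWO_support (c + c')
  · rw [Finset.sum_eq_single_of_mem _ hmem h]
  · rw [Finset.sum_eq_zero fun p hp => h p hp (by rintro rfl; exact hmem hp)]
    rw [Finset.mem_antidiagonal] at hmem
    by_contra h0
    exact hmem ⟨left_ne_zero_of_mul (Ne.symm h0), right_ne_zero_of_mul (Ne.symm h0), rfl⟩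

theorem coeff_mul_eq_zero {c' n : ℤ} (hf : VanishesBelow c f) (hg : VanishesBelow c' g)
    (hn : n < c + c') : (f * g).coeff n = 0 := by
  -- The bound for `f` is lowered to `n - c' < c`, where its coefficient is already zero.
  have h := (hf.mono (show n - c' ≤ c by lia)).coeff_mul_add hg
  rw [sub_add_cancel, hf _ (by lia), zero_mul] at h
  exact h

end VanishesBelow

/-- The family of Laurent series `A (y ^ χ)`, where `x` acts on `y ^ χ` as multiplication by `y`. -/
def symbol {v : Lat} (χ : Lat → ℤ) (A : PDO v) (m : Lat) : LaurentSeries TField :=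
  HahnSeries.ofSuppBddBelow (fun n => A.coeff (n - χ m) m) (by
    obtain ⟨N, hN⟩ := A.bddBelow
    refine ⟨N + χ m, fun n hn => ?_⟩
    by_contra h
    exact hn (by simp only; rw [hN _ (by lia), Pi.zero_apply]))

section Symbol

variable {v : Lat} {χ : Lat → ℤ} {S : PDO v}

theorem symbol_coeff (χ : Lat → ℤ) (A : PDO v) (m : Lat) (n : ℤ) :
    (symbol χ A m).coeff n = A.coeff (n - χ m) m := rfl

theorem symbol_vanishesBelow (hS : ∀ j < 0, S.coeff j = 0) (m : Lat) :
    VanishesBelow (χ m) (symbol χ S m) :=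
  fun n hn => by rw [symbol_coeff, hS _ (by lia), Pi.zero_apply]

/-- The hypothesis `hχ` says that the shift `x` multiplies `y ^ χ` by `y`, so acting on symbols is
multiplication of operators. -/
theorem coeff_sum_term_symbol (hχ : ∀ m (j : ℤ), χ (m + j • v) = χ m + j)
    (A : PDO v) (s : Finset ℤ) (m : Lat) (p : ℤ) :
    (actAt (symbol χ S) m (∑ j ∈ s, term (A.coeff j) (j • v))).coeff (χ m + p) =
      (∑ j ∈ s, A.coeff j * PDO.sh v j (S.coeff (p - j))) m := by
  rw [map_sum, HahnSeries.coeff_sum, Finset.sum_apply]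
  refine Finset.sum_congr rfl fun j _ => ?_
  rw [actAt_term, coeff_C_mul, symbol_coeff, hχ,
    show χ m + p - (χ m + j) = p - j by lia]
  rfl

/-- Since `S` has no negative powers, the discarded terms with `j > n` contribute only in degrees
above `n`. -/
theorem coeff_actAt_partLE (hχ : ∀ m (j : ℤ), χ (m + j • v) = χ m + j)
    (hS : ∀ j < 0, S.coeff j = 0) (A : PDO v) (m : Lat) {n p : ℤ} (hp : p ≤ n) :
    (actAt (symbol χ S) m (A.partLE n)).coeff (χ m + p) = (A * S).coeff p m := by
  obtain ⟨M, hM⟩ := A.bddBelow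
  rw [PDO.partLE_eq_sum A hM, coeff_sum_term_symbol hχ, PDO.mul_coeff,
    PDO.mulCoeff_eq hM hS p (Finset.Icc M n) (Finset.Icc_subset_Icc_right (by lia))]

/-- Both the discarded positive powers of `x` and the subtracted constants contribute only in
nonnegative degrees relative to `χ m`. -/
theorem coeff_actAt_deltaPartPos (hχ : ∀ m (j : ℤ), χ (m + j • v) = χ m + j)
    (hS : ∀ j < 0, S.coeff j = 0) (A : PDO v) (m : Lat) {p : ℤ} (hp : p < 0) :
    (actAt (symbol χ S) m A.deltaPartPos).coeff (χ m + p) = (A * S).coeff p m := by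
  obtain ⟨N, hN⟩ := A.exists_neg_bound
  have hinj : Function.Injective fun i : ℕ => -(i : ℤ) := fun a b h => by simpa using h
  have h1 : ∑ i ∈ Finset.range (N + 1), term (A.coeff (-(i : ℤ))) (-(i : ℤ) • v) =
      ∑ j ∈ (Finset.range (N + 1)).map ⟨_, hinj⟩, term (A.coeff j) (j • v) := by
    rw [Finset.sum_map]
    rfl
  rw [PDO.deltaPartPos_eq_sum A hN, Finset.sum_sub_distrib, h1, map_sub, HahnSeries.coeff_sub,
    coeff_sum_term_symbol hχ, PDO.mul_coeff, PDO.mulCoeff_eq hN hS p, map_sum,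
    VanishesBelow.sum (c := χ m) _ _ (by lia), sub_zero]
  · intro i _
    rw [actAt_term, add_zero]
    exact (symbol_vanishesBelow hS m).C_mul _
  · intro j hj
    rw [Finset.mem_Icc] at hj
    rw [Finset.mem_map]
    exact ⟨(-j).toNat, Finset.mem_range.mpr (by lia),
      by simp only [Function.Embedding.coeFn_mk]; lia⟩

/-- Dressing: `L ^ k S = S x⁻ᵏ`, and `x⁻ᵏ` acts on `y ^ χ` as `y⁻ᵏ`. -/
theorem coeff_single_mul_symbol (k : ℕ) (m : Lat) (hS : IsUnit S) (p : ℤ) :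
    (HahnSeries.single (-(k : ℤ)) 1 * symbol χ S m).coeff (χ m + p) =
      (dress S ^ k * S).coeff p m := by
  rw [HahnSeries.coeff_single_mul, one_mul, symbol_coeff, PDO.dress_pow_mul hS,
    PDO.mul_mono_pow_coeff]
  congr 1
  lia

theorem vanishesBelow_partLE_dress_sub (hχ : ∀ m (j : ℤ), χ (m + j • v) = χ m + j)
    (hS : ∀ j < 0, S.coeff j = 0) (hu : IsUnit S) (k : ℕ) (m : Lat) (n : ℤ) :
    VanishesBelow (χ m + (n + 1)) (actAt (symbol χ S) m ((dress S ^ k).partLE n) -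
      HahnSeries.single (-(k : ℤ)) 1 * symbol χ S m) := by
  intro p hp
  obtain ⟨q, rfl⟩ : ∃ q, p = χ m + q := ⟨p - χ m, by lia⟩
  rw [HahnSeries.coeff_sub, coeff_actAt_partLE hχ hS _ _ (by lia), coeff_single_mul_symbol _ _ hu,
    sub_self]

theorem vanishesBelow_deltaPartPos_dress_sub (hχ : ∀ m (j : ℤ), χ (m + j • v) = χ m + j)
    (hS : ∀ j < 0, S.coeff j = 0) (hu : IsUnit S) (k : ℕ) (m : Lat) :
    VanishesBelow (χ m) (actAt (symbol χ S) m (dress S ^ k).deltaPartPos -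
      HahnSeries.single (-(k : ℤ)) 1 * symbol χ S m) := by
  intro p hp
  obtain ⟨q, rfl⟩ : ∃ q, p = χ m + q := ⟨p - χ m, by lia⟩
  rw [HahnSeries.coeff_sub, coeff_actAt_deltaPartPos hχ hS _ _ (by lia),
    coeff_single_mul_symbol _ _ hu, sub_self]

theorem vanishesBelow_partLE (ψ : Lat → LaurentSeries TField) (A : PDO v) (m : Lat) (n c : ℤ)
    (h : ∀ j : ℤ, j ≤ n → VanishesBelow c (ψ (m + j • v))) :
    VanishesBelow c (actAt ψ m (A.partLE n)) := by
  obtain ⟨M, hM⟩ := A.bddBelow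
  rw [PDO.partLE_eq_sum A hM, map_sum]
  refine VanishesBelow.sum fun j hj => ?_
  rw [actAt_term]
  exact (h j (Finset.mem_Icc.mp hj).2).C_mul _

/-- Only differences `x ^ j - 1` occur, so it suffices that the low-order terms of `ψ` agree along
the shifts. -/
theorem vanishesBelow_deltaPartPos (ψ : Lat → LaurentSeries TField) (A : PDO v) (m : Lat) (c : ℤ)
    (h : ∀ j : ℤ, j ≤ 0 → VanishesBelow c (ψ (m + j • v) - ψ m)) :
    VanishesBelow c (actAt ψ m A.deltaPartPos) := by
  obtain ⟨N, hN⟩ := A.exists_neg_bound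
  rw [PDO.deltaPartPos_eq_sum A hN, map_sum]
  refine VanishesBelow.sum fun i _ => ?_
  rw [map_sub, actAt_term, actAt_term, add_zero, ← mul_sub]
  have hi : -(i : ℤ) ≤ 0 := by lia
  exact (h _ hi).C_mul _

end Symbol

/-! ### Non-exponential factors of the wave functions as Laurent series -/

theorem coeff_miwaSer (ε : ℂ) (i : Fin 3) (f : Ser Var) (n : ℤ) :
    (miwaSer ε i f).coeff n =
      if 0 ≤ n then algebraMap (Ser Var) TField (miwaCoeff ε i n.toNat f) else 0 := by
  rw [miwaSer, coeff_ofPowerSeries]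
  simp only [PowerSeries.coeff_mk]

theorem miwaSer_vanishesBelow (ε : ℂ) (i : Fin 3) (f : Ser Var) :
    VanishesBelow 0 (miwaSer ε i f) :=
  fun n hn => by rw [coeff_miwaSer, if_neg (by lia)]

theorem single_mul_miwaSer_vanishesBelow (N : ℤ) (a : TField) (ε : ℂ) (i : Fin 3) (f : Ser Var) :
    VanishesBelow N (HahnSeries.single N a * miwaSer ε i f) := fun n hn => by
  rw [HahnSeries.coeff_single_mul, miwaSer_vanishesBelow ε i f _ (by lia), mul_zero]

theorem coeff_single_mul_miwaSer_ne_zero (N : ℤ) {a : TField} (ha : a ≠ 0) (ε : ℂ) (i : Fin 3)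
    {f : Ser Var} (hf : f ≠ 0) : (HahnSeries.single N a * miwaSer ε i f).coeff N ≠ 0 := by
  rw [HahnSeries.coeff_single_mul, sub_self, coeff_miwaSer, if_pos le_rfl, Int.toNat_zero,
    miwaCoeff_zero]
  exact mul_ne_zero ha ((map_ne_zero_iff _ (IsFractionRing.injective (Ser Var) TField)).mpr hf)

theorem symbol_eq_single_mul_miwaSer {v : Lat} {S : PDO v} (χ : Lat → ℤ) (σ : Lat → TField)
    (i : Fin 3) (f τ : Lat → Ser Var)
    (hS : S = PDO.ofSeq v fun k m => σ m * waveCoeff i f τ k m) (m : Lat) :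
    symbol χ S m =
      HahnSeries.single (χ m) (σ m / algebraMap (Ser Var) TField (τ m)) *
        miwaSer (-1) i (f m) := by
  subst hS
  ext n
  rw [HahnSeries.coeff_single_mul, coeff_miwaSer, symbol_coeff, PDO.ofSeq_coeff]
  split_ifs
  · simp only [waveCoeff]
    ring
  · rw [Pi.zero_apply, mul_zero]

/-- An eigenvalue equation for Laurent series gives the one for the wave function. -/
theorem act_wave_of_actAt {v : Lat} {S : PDO v} (χ N : Lat → ℤ) (σ : Lat → TField)
    (i : Fin 3) (f τ : Lat → Ser Var) (hχ : ∀ m, χ m = locExp i * N m)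
    (hS : S = PDO.ofSeq v fun k m => σ m * waveCoeff i f τ k m) (D : DiffOp) (M k : ℤ)
    (hk : locExp i * M = -k)
    (h : ∀ m, actAt (symbol χ S) m D = HahnSeries.single (-k) 1 * symbol χ S m) :
    D.act (fun m n => σ m * waveSer i (N m) (f m) (τ m) n) =
      fun m => zPow M fun n => σ m * waveSer i (N m) (f m) (τ m) n := by
  apply act_wave_of_act_bareWave
  have h1 : ∀ m n, bareWave i N σ f τ m n = (symbol χ S m).coeff (locExp i * n) := by
    intro m n
    rw [symbol_eq_single_mul_miwaSer χ σ i f τ hS, HahnSeries.coeff_single_mul, coeff_miwaSer,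
      hχ, ← mul_sub, bareWave, miwa]
    split_ifs
    · ring
    · rw [map_zero, zero_div, mul_zero, mul_zero]
  funext m n
  have h2 := congrArg (fun F => F.coeff (locExp i * n)) (h m)
  simp only [actAt_eq_sum] at h2
  rw [HahnSeries.coeff_sum, HahnSeries.coeff_single_mul, one_mul] at h2
  rw [DiffOp.act, SkewMonoidAlgebra.sum_def', zPow, h1, mul_sub, hk, ← h2]
  refine Finset.sum_congr rfl fun w _ => ?_
  rw [coeff_C_mul, h1]

/-! ### Uniqueness from the bilinear residues -/

theorem VanishesBelow.exists_order {c : ℤ} {f : LaurentSeries TField} (hf : VanishesBelow c f)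
    (h0 : f ≠ 0) : ∃ o, c ≤ o ∧ VanishesBelow o f ∧ f.coeff o ≠ 0 := by
  have h1 : f.coeff f.order ≠ 0 := fun h => h0 (HahnSeries.coeff_order_eq_zero.mp h)
  refine ⟨f.order, ?_, fun n hn => HahnSeries.coeff_eq_zero_of_lt_order hn, h1⟩
  by_contra h
  exact h1 (hf _ (by lia))

/-- Each step assumes a nonzero `Φᵢ` of order `o` and picks `m'` so that its residue is the product
of two leading coefficients, while the other two residues vanish by degree or because the series is
already known to be zero. -/
theorem eq_zero_of_residues {Φ₁ Φ₂ Φ₃ : LaurentSeries TField}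
    {D₁ D₂ D₃ : Lat → LaurentSeries TField} (m : Lat)
    (h : ∀ m', (Φ₁ * D₁ m').coeff 1 = (Φ₂ * D₂ m').coeff (-1) + (Φ₃ * D₃ m').coeff (-1))
    (hD₁ : ∀ m', VanishesBelow m'.1 (D₁ m')) (hD₁' : ∀ m', (D₁ m').coeff m'.1 ≠ 0)
    (hD₂ : ∀ m', VanishesBelow (-m'.2) (D₂ m')) (hD₂' : ∀ m', (D₂ m').coeff (-m'.2) ≠ 0)
    (hD₃ : ∀ m', VanishesBelow (m'.2 - m'.1) (D₃ m'))
    (hD₃' : ∀ m', (D₃ m').coeff (m'.2 - m'.1) ≠ 0)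
    (h₁ : VanishesBelow (1 - m.1) Φ₁) (h₂ : VanishesBelow m.2 Φ₂)
    (h₃ : VanishesBelow (m.1 - m.2) Φ₃) : Φ₁ = 0 ∧ Φ₂ = 0 ∧ Φ₃ = 0 := by
  have e₁ : Φ₁ = 0 := by
    by_contra h0
    obtain ⟨o, ho, hv, hne⟩ := h₁.exists_order h0
    -- Now `D₁` starts in degree `1 - o`, and the two products on the right start in degree at least
    -- `0`, above `-1`.
    have h1 := h (1 - o, m.2)
    rw [h₂.coeff_mul_eq_zero (hD₂ _) (by simp only; lia),
      h₃.coeff_mul_eq_zero (hD₃ _) (by simp only; lia), add_zero] at h1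
    have h2 := hv.coeff_mul_add (hD₁ (1 - o, m.2))
    rw [show o + (1 - o) = 1 by lia, h1] at h2
    exact mul_ne_zero hne (hD₁' _) h2.symm
  subst e₁
  have e₂ : Φ₂ = 0 := by
    by_contra h0
    obtain ⟨o, ho, hv, hne⟩ := h₂.exists_order h0
    -- Now `D₂` starts in degree `-(o + 1)`, and `Φ₃ * D₃` in degree at least `o + 1 - m.2 ≥ 1`.
    have h1 := h (m.1, o + 1)
    rw [zero_mul, HahnSeries.coeff_zero,
      h₃.coeff_mul_eq_zero (hD₃ _) (by simp only; lia), add_zero] at h1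
    have h2 := hv.coeff_mul_add (hD₂ (m.1, o + 1))
    rw [show o + -(o + 1) = -1 by lia, ← h1] at h2
    exact mul_ne_zero hne (hD₂' _) h2.symm
  subst e₂
  refine ⟨rfl, rfl, ?_⟩
  by_contra h0
  obtain ⟨o, ho, hv, hne⟩ := h₃.exists_order h0
  have h1 := h (o + 1, 0)
  rw [zero_mul, HahnSeries.coeff_zero, zero_mul, HahnSeries.coeff_zero, zero_add] at h1
  have h2 := hv.coeff_mul_add (hD₃ (o + 1, 0))
  rw [show o + (0 - (o + 1)) = -1 by lia, ← h1] at h2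
  exact mul_ne_zero hne (hD₃' _) h2.symm

/-! ### The wave functions of the hierarchy -/

section Wave

variable (τ : Lat → Ser Var)

/-- The non-exponential factor of `Ψ₁`, a series in `y = z⁻¹`. -/
def psi1 : Lat → LaurentSeries TField := symbol (fun m => -m.1) (S1 τ)

/-- The non-exponential factor of `Ψ₂`, a series in `y = z`. -/
def psi2 : Lat → LaurentSeries TField := symbol (fun m => m.2) (S2 τ)

/-- The non-exponential factor of `Ψ₃`, a series in `y = z`. -/
def psi3 : Lat → LaurentSeries TField := symbol (fun m => m.1 - m.2) (S3 τ)

/-- The non-exponential factor of the adjoint of `Ψ₁`, times `τ`. -/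
def dual1 (m : Lat) : LaurentSeries TField :=
  HahnSeries.single m.1 1 * miwaSer 1 0 (τ m)

/-- The non-exponential factor of the adjoint of `Ψ₂`, times `τ`. -/
def dual2 (m : Lat) : LaurentSeries TField :=
  HahnSeries.single (-m.2) 1 * miwaSer 1 1 (τ (m - (1, 1)))

/-- The non-exponential factor of the adjoint of `Ψ₃`, times `τ`. -/
def dual3 (m : Lat) : LaurentSeries TField :=
  HahnSeries.single (m.2 - m.1) ((-1) ^ m.2) * miwaSer 1 2 (τ (m - (1, 0)))

theorem S1_eq : S1 τ = PDO.ofSeq _ fun k m => (1 : Lat → TField) m * waveCoeff 0 τ τ k m := by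
  simp only [Pi.one_apply, one_mul]
  rfl

theorem S2_eq : S2 τ = PDO.ofSeq _ fun k m =>
    (1 : Lat → TField) m * waveCoeff 1 (fun m => τ (m + (1, 1))) τ k m := by
  simp only [Pi.one_apply, one_mul]
  rfl

theorem S3_eq : S3 τ = PDO.ofSeq _ fun k m =>
    (fun m : Lat => (-1 : TField) ^ m.2) m * waveCoeff 2 (fun m => τ (m + (1, 0))) τ k m := rfl

theorem coeff_single_mul_mul (a b e n : ℤ) (x y : TField) (F G : LaurentSeries TField) :
    (HahnSeries.single a 1 * (HahnSeries.single b x * F) *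
      (HahnSeries.single e y * G)).coeff n = x * y * (F * G).coeff (n - a - b - e) := by
  rw [show HahnSeries.single a 1 * (HahnSeries.single b x * F) * (HahnSeries.single e y * G) =
    HahnSeries.single (a + b + e) (x * y) * (F * G) by
      rw [show x * y = 1 * x * y by rw [one_mul], ← HahnSeries.single_mul_single,
        ← HahnSeries.single_mul_single]
      ring, HahnSeries.coeff_single_mul]
  congr 2
  lia

theorem algebraMap_neg_one_zpow_smul (k : ℤ) (x : Ser Var) :
    algebraMap (Ser Var) TField ((-1 : ℂ) ^ k • x) =
      (-1 : TField) ^ k * algebraMap (Ser Var) TField x := by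
  rcases Int.even_or_odd k with hk | hk
  · rw [hk.neg_one_zpow, hk.neg_one_zpow, one_smul, one_mul]
  · rw [hk.neg_one_zpow, hk.neg_one_zpow, neg_smul, one_smul, map_neg, neg_one_mul]

variable {τ} {n₁ n₂ n₃ : ℕ}

/-- The bilinear equations at `t' = t`. -/
theorem IsKdVTau.residues (hKdV : IsKdVTau n₁ n₂ n₃ τ) (m m' : Lat) (l : ℕ) :
    (HahnSeries.single (-(n₁ * l : ℤ)) 1 * psi1 τ m * dual1 τ m').coeff 1 =
      (HahnSeries.single (-(n₂ * l : ℤ)) 1 * psi2 τ m * dual2 τ m').coeff (-1) +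
      (HahnSeries.single (-(n₃ * l : ℤ)) 1 * psi3 τ m * dual3 τ m').coeff (-1) := by
  have h := congrArg (fun x => algebraMap (Ser Var) TField (diag x)) (hKdV m m' l)
  simp only [map_add, map_smul, algebraMap_neg_one_zpow_smul, algebraMap_diag_bilinearRes] at h
  rw [psi1, psi2, psi3, symbol_eq_single_mul_miwaSer _ _ _ _ _ (S1_eq τ),
    symbol_eq_single_mul_miwaSer _ _ _ _ _ (S2_eq τ),
    symbol_eq_single_mul_miwaSer _ _ _ _ _ (S3_eq τ), dual1, dual2, dual3,
    coeff_single_mul_mul, coeff_single_mul_mul, coeff_single_mul_mul]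
  -- The residue is the coefficient of `z⁻¹`, which is `y` for the first family and `y⁻¹` for the
  -- others. The sign `(-1) ^ (m.2 + m'.2)` splits between `psi3` and `dual3`.
  rw [show (1 : ℤ) - -(n₁ * l) - -m.1 - m'.1 =
      locExp 0 * (-1 - (n₁ * l + m.1 - m'.1)) by simp only [locExp]; simp; ring, h,
    zpow_add₀ (neg_ne_zero.mpr one_ne_zero)]
  rw [show (-1 : ℤ) - -(n₂ * l) - m.2 - -m'.2 =
      locExp 1 * (-1 - (-(n₂ * l) + m.2 - m'.2)) by simp only [locExp]; simp; ring,
    show (-1 : ℤ) - -(n₃ * l) - (m.1 - m.2) - (m'.2 - m'.1) =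
      locExp 2 * (-1 - (-(n₃ * l) + m.1 - m.2 - m'.1 + m'.2)) by simp only [locExp]; simp; ring]
  simp only [Pi.one_apply]
  ring

/-- The coefficients of `D` depend on `m` and `t` but not on `z` or `m'`, so they pass through the
residues. The equations with `l = 0` handle `D`, and the one with `l = 1` handles the eigenvalues.
-/
theorem IsKdVTau.residues_act (hKdV : IsKdVTau n₁ n₂ n₃ τ) (D : DiffOp) (m m' : Lat) :
    ((actAt (psi1 τ) m D - HahnSeries.single (-(n₁ : ℤ)) 1 * psi1 τ m) * dual1 τ m').coeff 1 =
      ((actAt (psi2 τ) m D - HahnSeries.single (-(n₂ : ℤ)) 1 * psi2 τ m) *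
        dual2 τ m').coeff (-1) +
      ((actAt (psi3 τ) m D - HahnSeries.single (-(n₃ : ℤ)) 1 * psi3 τ m) *
        dual3 τ m').coeff (-1) := by
  have h1 := hKdV.residues m m' 1
  simp only [Nat.cast_one, mul_one] at h1
  have h0 : ∀ w, (psi1 τ w * dual1 τ m').coeff 1 =
      (psi2 τ w * dual2 τ m').coeff (-1) + (psi3 τ w * dual3 τ m').coeff (-1) := by
    intro w
    have := hKdV.residues w m' 0
    simpa only [Nat.cast_zero, mul_zero, neg_zero, HahnSeries.single_zero_one, one_mul] using this
  have hs : ∀ (ψ : Lat → LaurentSeries TField) (F : LaurentSeries TField) (n : ℤ),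
      (actAt ψ m D * F).coeff n =
        ∑ v ∈ D.support, D.coeff v m * (ψ (m + v.toAdd) * F).coeff n := by
    intro ψ F n
    rw [actAt_eq_sum, Finset.sum_mul, HahnSeries.coeff_sum]
    exact Finset.sum_congr rfl fun v _ => by rw [mul_assoc, coeff_C_mul]
  simp only [sub_mul, HahnSeries.coeff_sub, h1, hs, h0, mul_add, Finset.sum_add_distrib]
  ring

theorem psi1_leading (hτ : ∀ m, τ m ≠ 0) (m : Lat) : (psi1 τ m).coeff (-m.1) = 1 := by
  rw [psi1, symbol_coeff, sub_self]
  change waveCoeff 0 τ τ 0 m = 1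
  rw [waveCoeff, miwaCoeff_zero]
  exact div_self ((map_ne_zero_iff _ (IsFractionRing.injective (Ser Var) TField)).mpr (hτ m))

theorem PDO.ofSeq_coeff_neg {v : Lat} (s : ℕ → Coef) : ∀ j < 0, (PDO.ofSeq v s).coeff j = 0 :=
  fun _ hj => if_neg (by lia)

theorem psi1_vanishesBelow (m : Lat) : VanishesBelow (-m.1) (psi1 τ m) :=
  symbol_vanishesBelow (χ := fun m => -m.1) (PDO.ofSeq_coeff_neg _) m

theorem psi2_vanishesBelow (m : Lat) : VanishesBelow m.2 (psi2 τ m) :=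
  symbol_vanishesBelow (χ := fun m => m.2) (PDO.ofSeq_coeff_neg _) m

theorem psi3_vanishesBelow (m : Lat) : VanishesBelow (m.1 - m.2) (psi3 τ m) :=
  symbol_vanishesBelow (χ := fun m => m.1 - m.2) (PDO.ofSeq_coeff_neg _) m

/-- The leading coefficient of `psi1` is `1` at every lattice point, and its degree depends on `m.1`
only; it cancels in the difference. -/
theorem psi1_sub_vanishesBelow (hτ : ∀ m, τ m ≠ 0) (m m' : Lat) (h : m'.1 = m.1) :
    VanishesBelow (1 - m.1) (psi1 τ m' - psi1 τ m) := by
  intro n hn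
  rw [HahnSeries.coeff_sub]
  rcases lt_or_eq_of_le (show n ≤ -m.1 by lia) with h1 | rfl
  · rw [psi1_vanishesBelow m _ h1, psi1_vanishesBelow m' _ (by lia), sub_zero]
  · rw [psi1_leading hτ, ← h, psi1_leading hτ, sub_self]

/-- If `D₃` is the part of the Lax operator belonging to the third family of times, then the wave
functions are eigenfunctions of the Lax operator. -/
theorem actAt_lax_eq (hτ : ∀ m, τ m ≠ 0) (hKdV : IsKdVTau n₁ n₂ n₃ τ) (D₃ : DiffOp)
    (h1 : ∀ m, VanishesBelow (1 - m.1) (actAt (psi1 τ) m D₃))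
    (h2 : ∀ m, VanishesBelow m.2 (actAt (psi2 τ) m D₃))
    (h3 : ∀ m, VanishesBelow (m.1 - m.2)
      (actAt (psi3 τ) m D₃ - HahnSeries.single (-(n₃ : ℤ)) 1 * psi3 τ m)) (m : Lat) :
    actAt (psi1 τ) m (B1 τ n₁ + B2 τ n₂ + D₃) =
        HahnSeries.single (-(n₁ : ℤ)) 1 * psi1 τ m ∧
      actAt (psi2 τ) m (B1 τ n₁ + B2 τ n₂ + D₃) =
        HahnSeries.single (-(n₂ : ℤ)) 1 * psi2 τ m ∧
      actAt (psi3 τ) m (B1 τ n₁ + B2 τ n₂ + D₃) =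
        HahnSeries.single (-(n₃ : ℤ)) 1 * psi3 τ m := by
  obtain ⟨u1, u2, -, -⟩ := isUnit_wave τ hτ
  have key := eq_zero_of_residues m (hKdV.residues_act (B1 τ n₁ + B2 τ n₂ + D₃) m)
    (fun m' => single_mul_miwaSer_vanishesBelow _ _ _ _ _)
    (fun m' => coeff_single_mul_miwaSer_ne_zero _ one_ne_zero _ _ (hτ _))
    (fun m' => single_mul_miwaSer_vanishesBelow _ _ _ _ _)
    (fun m' => coeff_single_mul_miwaSer_ne_zero _ one_ne_zero _ _ (hτ _))
    (fun m' => single_mul_miwaSer_vanishesBelow _ _ _ _ _)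
    (fun m' => coeff_single_mul_miwaSer_ne_zero _
      (zpow_ne_zero _ (neg_ne_zero.mpr one_ne_zero)) _ _ (hτ _))
  simp only [sub_eq_zero] at key
  apply key
  -- On `psi1`, `B1` reproduces the eigenvalue through degree `-m.1`, and `B2` shifts only `m.2`, so
  -- its differences remove the leading term.
  · rw [map_add, map_add, add_assoc, add_sub_right_comm]
    refine VanishesBelow.add ?_ (VanishesBelow.add ?_ (h1 m))
    · refine (vanishesBelow_partLE_dress_sub (χ := fun m => -m.1) (S := S1 τ) ?_
        (PDO.ofSeq_coeff_neg _) u1 n₁ m 0).mono ?_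
      · intro m j
        simp [add_comm]
      · lia
    · refine vanishesBelow_deltaPartPos _ _ _ _ fun j _ => psi1_sub_vanishesBelow hτ _ _ ?_
      simp
  -- On `psi2`, `B2` reproduces the eigenvalue below degree `m.2`, and `B1` leaves `m.2` unchanged.
  · rw [map_add, map_add, add_sub_right_comm, add_comm (actAt _ _ _), add_sub_right_comm]
    refine VanishesBelow.add (VanishesBelow.add ?_ ?_) (h2 m)
    · refine vanishesBelow_deltaPartPos_dress_sub (χ := fun m => m.2) (S := S2 τ) ?_
        (PDO.ofSeq_coeff_neg _) u2 n₂ m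
      intro m j
      simp
    · refine vanishesBelow_partLE _ _ _ _ _ fun j _ => (psi2_vanishesBelow _).mono ?_
      simp
  -- On `psi3`, nonnegative powers of `Λ₁` and of `Λ₂⁻¹` do not decrease the starting degree `m.1 -
  -- m.2`.
  · rw [map_add, map_add, add_sub_assoc]
    refine VanishesBelow.add (VanishesBelow.add ?_ ?_) (h3 m)
    · refine vanishesBelow_partLE _ _ _ _ _ fun j hj => (psi3_vanishesBelow _).mono ?_
      simp
      lia
    · refine vanishesBelow_deltaPartPos _ _ _ _ fun j hj => ?_
      refine VanishesBelow.sub ((psi3_vanishesBelow _).mono ?_) (psi3_vanishesBelow m)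
      simp
      lia

/-- The eigenvalue equations for the wave functions follow from those for Laurent series. -/
theorem act_Psi_of_actAt (D : DiffOp)
    (h : ∀ m, actAt (psi1 τ) m D = HahnSeries.single (-(n₁ : ℤ)) 1 * psi1 τ m ∧
      actAt (psi2 τ) m D = HahnSeries.single (-(n₂ : ℤ)) 1 * psi2 τ m ∧
      actAt (psi3 τ) m D = HahnSeries.single (-(n₃ : ℤ)) 1 * psi3 τ m) :
    (D.act (Psi1 τ) = fun m => zPow (n₁ : ℤ) (Psi1 τ m)) ∧
      (D.act (Psi2 τ) = fun m => zPow (-(n₂ : ℤ)) (Psi2 τ m)) ∧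
      (D.act (Psi3 τ) = fun m => zPow (-(n₃ : ℤ)) (Psi3 τ m)) := by
  have e1 : Psi1 τ = fun m n => (1 : Lat → TField) m * waveSer 0 m.1 (τ m) (τ m) n := by
    funext m n
    rw [Pi.one_apply, one_mul, Psi1]
  have e2 : Psi2 τ = fun m n =>
      (1 : Lat → TField) m * waveSer 1 m.2 (τ (m + (1, 1))) (τ m) n := by
    funext m n
    rw [Pi.one_apply, one_mul, Psi2]
  refine ⟨?_, ?_, ?_⟩
  · rw [e1]
    exact act_wave_of_actAt _ (fun m => m.1) _ 0 τ τ (fun m => by simp [locExp]) (S1_eq τ) D n₁ n₁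
      (by simp [locExp]) fun m => (h m).1
  · rw [e2]
    exact act_wave_of_actAt _ (fun m => m.2) _ 1 (fun m => τ (m + (1, 1))) τ
      (fun m => by simp [locExp]) (S2_eq τ) D _ n₂ (by simp [locExp]) fun m => (h m).2.1
  · exact act_wave_of_actAt _ (fun m => m.1 - m.2) (fun m => (-1) ^ m.2) 2
      (fun m => τ (m + (1, 0))) τ (fun m => by simp [locExp]) (S3_eq τ) D _ n₃
      (by simp [locExp]) fun m => (h m).2.2

end Wave

end ThreeKP

end

/-! ### The two choices of the third part of the Lax operator -/

theorem mainTheorem2 (n₁ n₂ n₃ : ℕ) (τ : ThreeKP.Lat → ThreeKP.Ser ThreeKP.Var)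
    (hτ : ∀ m, τ m ≠ 0) (hKdV : ThreeKP.IsKdVTau n₁ n₂ n₃ τ) :
    ((ThreeKP.laxOp n₁ n₂ n₃ τ).act (ThreeKP.Psi1 τ) =
        fun m => ThreeKP.zPow (n₁ : ℤ) (ThreeKP.Psi1 τ m)) ∧
    ((ThreeKP.laxOp n₁ n₂ n₃ τ).act (ThreeKP.Psi2 τ) =
        fun m => ThreeKP.zPow (-(n₂ : ℤ)) (ThreeKP.Psi2 τ m)) ∧
    ((ThreeKP.laxOp n₁ n₂ n₃ τ).act (ThreeKP.Psi3 τ) =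
        fun m => ThreeKP.zPow (-(n₃ : ℤ)) (ThreeKP.Psi3 τ m)) ∧
    ((ThreeKP.laxOp' n₁ n₂ n₃ τ).act (ThreeKP.Psi1 τ) =
        fun m => ThreeKP.zPow (n₁ : ℤ) (ThreeKP.Psi1 τ m)) ∧
    ((ThreeKP.laxOp' n₁ n₂ n₃ τ).act (ThreeKP.Psi2 τ) =
        fun m => ThreeKP.zPow (-(n₂ : ℤ)) (ThreeKP.Psi2 τ m)) ∧
    ((ThreeKP.laxOp' n₁ n₂ n₃ τ).act (ThreeKP.Psi3 τ) =
        fun m => ThreeKP.zPow (-(n₃ : ℤ)) (ThreeKP.Psi3 τ m)) := by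
  obtain ⟨-, -, u3, u3'⟩ := ThreeKP.isUnit_wave τ hτ
  obtain ⟨h1, h2, h3⟩ := ThreeKP.act_Psi_of_actAt (ThreeKP.laxOp n₁ n₂ n₃ τ)
    (ThreeKP.actAt_lax_eq hτ hKdV (ThreeKP.B3 τ n₃)
      -- Strictly negative powers of `Λ₁` raise the starting degree `-m.1` of `psi1` by at least
      -- one, as required; powers `≤ 0` would not suffice.
      (fun m => ThreeKP.vanishesBelow_partLE _ _ _ _ _ fun j hj =>
        (ThreeKP.psi1_vanishesBelow _).mono (by simp; lia))
      (fun m => ThreeKP.vanishesBelow_partLE _ _ _ _ _ fun j hj =>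
        (ThreeKP.psi2_vanishesBelow _).mono (by simp))
      (fun m => (ThreeKP.vanishesBelow_partLE_dress_sub (χ := fun m => m.1 - m.2)
        (S := ThreeKP.S3 τ) (fun m j => by simp; ring) (ThreeKP.PDO.ofSeq_coeff_neg _) u3 n₃ m
        (-1)).mono (by simp)))
  obtain ⟨h1', h2', h3'⟩ := ThreeKP.act_Psi_of_actAt (ThreeKP.laxOp' n₁ n₂ n₃ τ)
    (ThreeKP.actAt_lax_eq hτ hKdV (ThreeKP.B3' τ n₃)
      (fun m => ThreeKP.vanishesBelow_deltaPartPos _ _ _ _ fun j _ =>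
        ThreeKP.psi1_sub_vanishesBelow hτ _ _ (by simp))
      (fun m => ThreeKP.vanishesBelow_deltaPartPos _ _ _ _ fun j hj =>
        ((ThreeKP.psi2_vanishesBelow _).mono (by simp; lia)).sub (ThreeKP.psi2_vanishesBelow m))
      -- `psi3` is built from `S3`, but `S3'` has the same coefficients and `Λ₂⁻¹` also raises `m.1
      -- - m.2` by one, so both have the same symbol.
      (fun m => ThreeKP.vanishesBelow_deltaPartPos_dress_sub (χ := fun m => m.1 - m.2)
        (S := ThreeKP.S3' τ) (fun m j => by simp; ring) (ThreeKP.PDO.ofSeq_coeff_neg _) u3' n₃ m))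
  exact ⟨h1, h2, h3, h1', h2', h3'⟩
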